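/- Let $E$ be a separable Banach space and, for $\Omega\subset E$, let $\beta(\Omega)$ be the Hausdorff measure of noncompactness, i.e. the infimum of all $r>0$ such that $\Omega$ can be covered by finitely many balls of radius $r$. Let $\{A(\lambda):D(A(\lambda))\to E\}_{\lambda\in[0,1]}$ be a family of densely defined linear operators such that (A1) for every $\lambda\in[0,1]$, $-A(\lambda)$ is the infinitesimal generator of a $C_0$ semigroup $\{S_{A(\lambda)}(t)\}_{t\ge 0}$ of bounded linear operators on $E$, and there is $\omega>0$ such that $\|S_{A(\lambda)}(t)\|\le e^{-\omega t}$ for all $t\ge 0$ and $\lambda\in[0,1]$; (A2) if $\lambda_n\to\lambda_0$ in $[0,1]$, then $(\nu I+A(\lambda_n))^{-1}u\to(\nu I+A(\lambda_0))^{-1}u$ for every $\nu>-\omega$ and $u\in E$. Let $T>0$, put $J=[0,T]$, and let $F:J\times E\times[0,1]\to E$ be a continuous map such that (F1) for every $x\in E$ there are $\delta_x,L_x>0$ with $\|F(t,x_1,\lambda)-F(t,x_2,\lambda)\|\le L_x\|x_1-x_2\|$ for all $x_1,x_2\in B(x,\delta_x)$, $t\in J$, $\lambda\in[0,1]$; (F2)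 there is $c>0$ with $\|F(t,x,\lambda)\|\le c(1+\|x\|)$ for all $t\in J$, $x\in E$, $\lambda\in[0,1]$; (F3) there is $k\ge 0$ with $\beta(F(J\times\Omega\times[0,1]))\le k\,\beta(\Omega)$ for every bounded $\Omega\subset E$. A mild solution on $J$ of $\dot u(t)=-A(\lambda)u(t)+F(t,u(t),\lambda)$ with $u(0)=x$ is a continuous function $u:J\to E$ such that $u(t)=S_{A(\lambda)}(t)x+\int_0^t S_{A(\lambda)}(t-\tau)F(\tau,u(\tau),\lambda)\,d\tau$ for all $t\in J$. Then: (i) (Existence) For every $x\in E$ and $\lambda\in[0,1]$ there is a unique mild solution $u(\cdot;0,T,x,\lambda)$ on $[0,T]$ with $u(0)=x$. The same holds for $T=+\infty$, that is, with $J=[0,+\infty)$ in the assumptions on $F$ and in the notion of mild solution. (ii) (Continuity) If $(x_n,\lambda_n)\to(x_0,\lambda_0)$ in $E\times[0,1]$, then $u(\cdot;0,T,x_n,\lambda_n)\to u(\cdot;0,T,x_0,\lambda_0)$ in $C([0,T],E)$. (iii) (Compactness) If $\Phi_t(x,\lambda):=u(t;0,T,x,\lambda)$ for $t\in[0,T]$,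 then $\beta(\Phi_t(\Omega\times[0,1]))\le e^{(k-\omega)t}\beta(\Omega)$ for every $t\in[0,T]$ and every bounded $\Omega\subset E$. -/

import Mathlib

open Set Filter Topology MeasureTheory
open scoped unitInterval ENNReal

noncomputable section

namespace EvolutionFamily

variable {E : Type*} [NormedAddCommGroup E] [NormedSpace ℝ E]

/-- The Hausdorff measure of noncompactness: the infimum of all `r > 0` such that `Ω` is covered by
finitely many balls of radius `r`. It takes values in `[0, ∞]`, and is `∞` exactly for unbounded
sets. -/
def hausdorffMNC (Ω : Set E) : ℝ≥0∞ :=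
  ⨅ (r : ℝ) (_ : 0 < r ∧ ∃ s : Set E, s.Finite ∧ Ω ⊆ ⋃ c ∈ s, Metric.ball c r), ENNReal.ofReal r

/-- A `C₀` semigroup of bounded linear operators; only the values `S t` with `t ≥ 0` matter. -/
structure IsC0Semigroup (S : ℝ → E →L[ℝ] E) : Prop where
  map_zero : S 0 = ContinuousLinearMap.id ℝ E
  map_add : ∀ s t : ℝ, 0 ≤ s → 0 ≤ t → S (s + t) = (S s).comp (S t)
  tendsto_zero : ∀ x : E, Tendsto (fun t : ℝ => S t x) (𝓝[>] 0) (𝓝 x)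

/-- `G` is the infinitesimal generator of `S`: the domain of `G` consists of those `x` for which
`(S h x - x) / h` has a limit as `h → 0⁺`, and `G x` is that limit. -/
def IsInfinitesimalGenerator (G : E →ₗ.[ℝ] E) (S : ℝ → E →L[ℝ] E) : Prop :=
  ∀ x y : E, (x, y) ∈ G.graph ↔ Tendsto (fun h : ℝ => h⁻¹ • (S h x - x)) (𝓝[>] 0) (𝓝 y)

open Classical in
/-- The resolvent `R(ν : G) u = (ν I - G)⁻¹ u`: the unique `x` in the domain of `G` such that
`ν x - G x = u`. (It is set to `0` when there is no such unique `x`, which never happens for `ν` in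
the resolvent set of `G`.) -/
def resolventOp (G : E →ₗ.[ℝ] E) (ν : ℝ) (u : E) : E :=
  if h : ∃! x : G.domain, ν • (x : E) - G x = u then ((h.choose : G.domain) : E) else 0

/-- Resolvent continuity of a family of operators `A(lam)`, where `-A(lam)` has all `ν > -ω` in its
resolvent set: `R(ν : -A(lₙ)) u → R(ν : -A(l₀)) u` whenever `lₙ → l₀`. -/
def ResolventContinuous (A : I → E →ₗ.[ℝ] E) (ω : ℝ) : Prop :=
  ∀ (l : ℕ → I) (l₀ : I), Tendsto l atTop (𝓝 l₀) → ∀ ν : ℝ, -ω < ν → ∀ u : E,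
    Tendsto (fun n => resolventOp (-(A (l n))) ν u) atTop (𝓝 (resolventOp (-(A l₀)) ν u))

/-- The conditions on the perturbation `F(t, x, lam)`, with `t` in the time interval `J`. -/
structure IsPerturbation (F : ℝ × E × I → E) (J : Set ℝ) (k : ℝ) : Prop where
  continuousOn : ContinuousOn F (J ×ˢ univ)
  locallyLipschitz : ∀ x : E, ∃ δ > 0, ∃ L > 0, ∀ x₁ ∈ Metric.ball x δ, ∀ x₂ ∈ Metric.ball x δ,
    ∀ t ∈ J, ∀ lam : I, ‖F (t, x₁, lam) - F (t, x₂, lam)‖ ≤ L * ‖x₁ - x₂‖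
  linearGrowth : ∃ c > 0, ∀ x : E, ∀ t ∈ J, ∀ lam : I, ‖F (t, x, lam)‖ ≤ c * (1 + ‖x‖)
  k_nonneg : 0 ≤ k
  setContraction : ∀ Ω : Set E, Bornology.IsBounded Ω →
    hausdorffMNC (F '' (J ×ˢ Ω ×ˢ univ)) ≤ ENNReal.ofReal k * hausdorffMNC Ω

/-- `u` is a mild solution on the time interval `J` (equal to `[0, T]` or `[0, ∞)`) of
`u' = -A u + F(t, u, lam)`, `u(0) = x`, where `S` is the semigroup generated by `-A`. -/
def IsMildSolution (S : ℝ → E →L[ℝ] E) (F : ℝ × E × I → E) (lam : I) (J : Set ℝ) (x : E)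
    (u : ℝ → E) : Prop :=
  ContinuousOn u J ∧
    ∀ t ∈ J, u t = S t x + ∫ τ in (0 : ℝ)..t, S (t - τ) (F (τ, u τ, lam))

end EvolutionFamily

end

/-!
Mild solutions are the solutions of a nonlinear Volterra equation
`u(t) = q(t) + ∫₀ᵗ K(t, τ, u(τ)) dτ` with `K(t, τ, y) = S(t - τ) F(τ, y, lam)`. Picard iteration
solves it on short intervals, linear growth and Grönwall's inequality prevent blow-up, so that local
solutions continue to the whole interval; Grönwall's inequality near a given solution yields
uniqueness and continuous dependence.

The joint continuity of `(lam, t, x) ↦ S_lam(t) x` is the Trotter–Kato theorem. As the semigroups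
are exponentially stable, the resolvent at `0` alone suffices for it: with `R = ∫₀^∞ S(t) dt` and
its counterpart `R'` for `S'`, the difference `R' S(t) R - S'(t) R' R` is the integral over `[0, t]`
of the derivative `S'(t - s) (R - R') S(s)` of `s ↦ S'(t - s) R' S(s) R`.

In a separable space the measure of noncompactness of a bounded family `(xᵢ)` is the infimum over
an exhausting sequence `V₀ ⊆ V₁ ⊆ …` of finite-dimensional subspaces of `supᵢ dist(xᵢ, Vₘ)`. Since
the distance to a subspace is a seminorm, it follows that `β(∫ fᵢ) ≤ ∫ β(fᵢ)`. Hence the measure of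
noncompactness `g` of the solutions satisfies
`g(t) ≤ e^{-ωt} β(Ω) + ∫₀ᵗ e^{-ω(t - τ)} k g(τ) dτ`, and Grönwall's inequality for `e^{ωt} g(t)`
gives the exponential bound.
-/

noncomputable section

open scoped NNReal

namespace EvolutionFamily

section Gronwall

theorem le_mul_exp_of_continuous_of_le_add_integral {h : ℝ → ℝ} {A k a b : ℝ} (hk : 0 ≤ k)
    (hcont : Continuous h) (hle : ∀ t ∈ Icc a b, h t ≤ A + k * ∫ τ in a..t, h τ) :
    ∀ t ∈ Icc a b, h t ≤ A * Real.exp (k * (t - a)) := by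
  set H : ℝ → ℝ := fun t => A + k * ∫ τ in a..t, h τ
  have hderiv : ∀ t, HasDerivAt H (k * h t) t := fun t =>
    ((hcont.integral_hasStrictDerivAt a t).hasDerivAt.const_mul k).const_add A
  have hbound := le_gronwallBound_of_liminf_deriv_right_le (f := H) (δ := A) (K := k) (ε := 0)
    (a := a) (b := b) (fun t _ => (hderiv t).continuousAt.continuousWithinAt)
    (fun t _ _ => (hderiv t).hasDerivWithinAt.liminf_right_slope_le) (by simp [H])
    fun t ht => by
      rw [add_zero]
      exact mul_le_mul_of_nonneg_left (hle t (Ico_subset_Icc_self ht)) hk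
  intro t ht
  simpa only [gronwallBound_ε0] using (hle t ht).trans (hbound t ht)

theorem le_mul_exp_of_le_add_integral {h : ℝ → ℝ} {A k a b : ℝ} (hk : 0 ≤ k)
    (hint : IntegrableOn h (Icc a b)) (hle : ∀ t ∈ Icc a b, h t ≤ A + k * ∫ τ in a..t, h τ) :
    ∀ t ∈ Icc a b, h t ≤ A * Real.exp (k * (t - a)) := by
  intro s hs
  have hab : a ≤ b := hs.1.trans hs.2
  set H : ℝ → ℝ := IccExtend hab ((Icc a b).domRestrict fun t => A + k * ∫ τ in a..t, h τ)
  have hH : ∀ t ∈ Icc a b, H t = A + k * ∫ τ in a..t, h τ := fun t ht => IccExtend_of_mem hab _ ht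
  have hHcont : Continuous H := by
    have hprim := intervalIntegral.continuousOn_primitive_interval (μ := volume)
      (hint.mono_set (uIcc_of_le hab).subset)
    rw [uIcc_of_le hab] at hprim
    exact (continuousOn_iff_continuous_domRestrict.1
      (continuousOn_const.add (continuousOn_const.mul hprim))).Icc_extend'
  have hhH : ∀ t ∈ Icc a b, h t ≤ H t := fun t ht => (hle t ht).trans_eq (hH t ht).symm
  have hHle : ∀ t ∈ Icc a b, H t ≤ A + k * ∫ τ in a..t, H τ := fun t ht => by
    have hsub : Icc a t ⊆ Icc a b := Icc_subset_Icc_right ht.2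
    have hint' : IntervalIntegrable h volume a t :=
      (hint.mono_set ((uIcc_of_le ht.1).trans_subset hsub)).intervalIntegrable
    rw [hH t ht]
    gcongr
    exact intervalIntegral.integral_mono_on ht.1 hint' (hHcont.intervalIntegrable _ _)
      fun τ hτ => hhH τ (hsub hτ)
  exact (hhH s hs).trans (le_mul_exp_of_continuous_of_le_add_integral hk hHcont hHle s hs)

theorem le_mul_exp_of_le_add_lintegral {h : ℝ → ℝ≥0∞} {B : ℝ≥0∞} {k a b : ℝ} (hk : 0 ≤ k)
    (hmeas : Measurable h) (hfin : ∫⁻ τ in Icc a b, h τ ≠ ∞)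
    (hle : ∀ t ∈ Icc a b, h t ≤ B + ENNReal.ofReal k * ∫⁻ τ in Icc a t, h τ) :
    ∀ t ∈ Icc a b, h t ≤ B * ENNReal.ofReal (Real.exp (k * (t - a))) := by
  rcases eq_or_ne B ∞ with rfl | hB
  · intro t _
    rw [ENNReal.top_mul (ENNReal.ofReal_pos.2 (Real.exp_pos _)).ne']
    exact le_top
  have hfin' : ∀ t ∈ Icc a b, ∫⁻ τ in Icc a t, h τ ≠ ∞ := fun t ht =>
    ne_top_of_le_ne_top hfin (lintegral_mono_set (Icc_subset_Icc_right ht.2))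
  have hh : ∀ t ∈ Icc a b, h t ≠ ∞ := fun t ht => ne_top_of_le_ne_top
    (ENNReal.add_ne_top.2 ⟨hB, ENNReal.mul_ne_top ENNReal.ofReal_ne_top (hfin' t ht)⟩) (hle t ht)
  have hreal := le_mul_exp_of_le_add_integral (h := fun t => (h t).toReal) (A := B.toReal) hk
    (integrable_toReal_of_lintegral_ne_top hmeas.aemeasurable hfin) fun t ht => by
      have hae : ∀ᵐ τ ∂volume.restrict (Icc a t), h τ < ∞ :=
        ae_lt_top hmeas (hfin' t ht)
      rw [intervalIntegral.integral_of_le ht.1, ← integral_Icc_eq_integral_Ioc,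
        integral_toReal hmeas.aemeasurable hae, ← ENNReal.toReal_ofReal hk, ← ENNReal.toReal_mul,
        ← ENNReal.toReal_add hB (ENNReal.mul_ne_top ENNReal.ofReal_ne_top (hfin' t ht))]
      exact ENNReal.toReal_mono
        (ENNReal.add_ne_top.2 ⟨hB, ENNReal.mul_ne_top ENNReal.ofReal_ne_top (hfin' t ht)⟩)
        (hle t ht)
  intro t ht
  rw [← ENNReal.ofReal_toReal (hh t ht), ← ENNReal.ofReal_toReal hB,
    ← ENNReal.ofReal_mul ENNReal.toReal_nonneg]
  exact ENNReal.ofReal_le_ofReal (hreal t ht)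

theorem ofReal_exp_mul_ofReal_exp (x y : ℝ) :
    ENNReal.ofReal (Real.exp x) * ENNReal.ofReal (Real.exp y) =
      ENNReal.ofReal (Real.exp (x + y)) := by
  rw [← ENNReal.ofReal_mul (Real.exp_pos x).le, Real.exp_add]

theorem le_mul_exp_of_le_exp_mul_add_lintegral {g : ℝ → ℝ≥0∞} {B : ℝ≥0∞} {k ω a b : ℝ}
    (hk : 0 ≤ k) (hmeas : Measurable g) (hfin : ∫⁻ τ in Icc a b, g τ ≠ ∞)
    (hle : ∀ t ∈ Icc a b, g t ≤ ENNReal.ofReal (Real.exp (-ω * (t - a))) * B +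
      ∫⁻ τ in Icc a t, ENNReal.ofReal (Real.exp (-ω * (t - τ))) * (ENNReal.ofReal k * g τ)) :
    ∀ t ∈ Icc a b, g t ≤ ENNReal.ofReal (Real.exp ((k - ω) * (t - a))) * B := by
  set e : ℝ → ℝ≥0∞ := fun x => ENNReal.ofReal (Real.exp x) with he
  have hmul : ∀ x y, e x * e y = e (x + y) := ofReal_exp_mul_ofReal_exp
  have hinv : ∀ x, e (-x) * e x = 1 := fun x => by
    rw [hmul, neg_add_cancel]
    simp only [he, Real.exp_zero, ENNReal.ofReal_one]
  have hemeas : Measurable e := ENNReal.measurable_ofReal.comp Real.measurable_exp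
  set h : ℝ → ℝ≥0∞ := fun t => e (ω * (t - a)) * g t with hh
  have hhmeas : Measurable h := (hemeas.comp (by fun_prop)).mul hmeas
  have hhfin : ∫⁻ τ in Icc a b, h τ ≠ ∞ := by
    refine ne_top_of_le_ne_top (ENNReal.mul_ne_top (a := e (|ω| * (b - a))) ENNReal.ofReal_ne_top
      hfin) ?_
    rw [← lintegral_const_mul _ hmeas]
    refine setLIntegral_mono' measurableSet_Icc fun τ hτ => ?_
    refine mul_le_mul_left (ENNReal.ofReal_le_ofReal (Real.exp_le_exp.2 ?_)) _
    exact mul_le_mul (le_abs_self ω) (by linarith [hτ.2]) (sub_nonneg.2 hτ.1) (abs_nonneg ω)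
  have hhle : ∀ t ∈ Icc a b, h t ≤ B + ENNReal.ofReal k * ∫⁻ τ in Icc a t, h τ := fun t ht =>
    calc h t ≤ e (ω * (t - a)) * (e (-ω * (t - a)) * B +
          ∫⁻ τ in Icc a t, e (-ω * (t - τ)) * (ENNReal.ofReal k * g τ)) :=
          mul_le_mul_right (hle t ht) _
      _ = B + ∫⁻ τ in Icc a t, ENNReal.ofReal k * h τ := by
        rw [mul_add, ← mul_assoc, neg_mul, mul_comm (e _) (e _), hinv, one_mul,
          ← lintegral_const_mul' _ _ ENNReal.ofReal_ne_top]
        congr 2 with τ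
        rw [← mul_assoc, hmul, mul_left_comm, hh]
        ring_nf
      _ = _ := by rw [lintegral_const_mul _ hhmeas]
  intro t ht
  calc g t = e (-(ω * (t - a))) * h t := by rw [hh, ← mul_assoc, hinv, one_mul]
    _ ≤ e (-(ω * (t - a))) * (B * e (k * (t - a))) :=
      mul_le_mul_right (le_mul_exp_of_le_add_lintegral hk hhmeas hhfin hhle t ht) _
    _ = e ((k - ω) * (t - a)) * B := by
      rw [mul_left_comm, hmul, mul_comm]
      ring_nf

end Gronwall

section UniformlyLocallyLipschitz

variable {ι κ α β : Type*} [PseudoMetricSpace α] [PseudoMetricSpace β]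

/-- A family of maps which is locally Lipschitz with constants and neighbourhoods independent of
the index. -/
def UniformlyLocallyLipschitz (f : ι → α → β) : Prop :=
  ∀ x, ∃ L : ℝ≥0, ∃ s ∈ 𝓝 x, ∀ i, LipschitzOnWith L (f i) s

namespace UniformlyLocallyLipschitz

variable {f : ι → α → β}

theorem comp_index (hf : UniformlyLocallyLipschitz f) (g : κ → ι) :
    UniformlyLocallyLipschitz fun j => f (g j) := fun x =>
  let ⟨L, s, hs, h⟩ := hf x
  ⟨L, s, hs, fun j => h (g j)⟩

theorem exists_closedBall (hf : UniformlyLocallyLipschitz f) (x : α) :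
    ∃ L : ℝ≥0, ∃ r > 0, ∀ i, LipschitzOnWith L (f i) (Metric.closedBall x r) := by
  obtain ⟨L, s, hs, h⟩ := hf x
  obtain ⟨r, hr, hrs⟩ := Metric.nhds_basis_closedBall.mem_iff.1 hs
  exact ⟨L, r, hr, fun i => (h i).mono hrs⟩

theorem exists_dist_le_mul_of_isCompact (hf : UniformlyLocallyLipschitz f) {C : Set α}
    (hC : IsCompact C) :
    ∃ L : ℝ≥0, ∃ δ > 0, ∀ y ∈ C, ∀ z, dist z y < δ → ∀ i, dist (f i z) (f i y) ≤ L * dist z y := by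
  refine hC.induction_on (p := fun C => ∃ L : ℝ≥0, ∃ δ > 0, ∀ y ∈ C, ∀ z, dist z y < δ → ∀ i,
    dist (f i z) (f i y) ≤ L * dist z y) ⟨0, 1, one_pos, by simp⟩ ?mono ?union ?nhds
  case mono =>
    rintro s t hst ⟨L, δ, hδ, h⟩
    exact ⟨L, δ, hδ, fun y hy => h y (hst hy)⟩
  case union =>
    rintro s t ⟨L, δ, hδ, h⟩ ⟨L', δ', hδ', h'⟩
    refine ⟨max L L', min δ δ', lt_min hδ hδ', ?_⟩
    rintro y (hy | hy) z hz i
    · refine (h y hy z (hz.trans_le (min_le_left _ _)) i).trans ?_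
      gcongr
      exact le_max_left _ _
    · refine (h' y hy z (hz.trans_le (min_le_right _ _)) i).trans ?_
      gcongr
      exact le_max_right _ _
  case nhds =>
    intro x _
    obtain ⟨L, r, hr, h⟩ := hf.exists_closedBall x
    refine ⟨_, mem_nhdsWithin_of_mem_nhds (Metric.closedBall_mem_nhds x (half_pos hr)), L, r / 2,
      half_pos hr, fun y hy z hz i => (h i).dist_le_mul z ?_ y ?_⟩
    · exact Metric.mem_closedBall.2 ((dist_triangle z y x).trans
        ((add_le_add hz.le hy).trans_eq (add_halves r)))
    · exact Metric.closedBall_subset_closedBall (half_le_self hr.le) hy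

end UniformlyLocallyLipschitz

end UniformlyLocallyLipschitz

section Volterra

variable {E : Type*} [NormedAddCommGroup E] {K : ℝ → ℝ → E → E} {q : ℝ → E} {a b : ℝ} {u v : ℝ → E}

theorem continuousOn_volterra_integrand {J : Set ℝ}
    (hK : Continuous fun p : ℝ × ℝ × E => K p.1 p.2.1 p.2.2) (hu : ContinuousOn u J) (t : ℝ) :
    ContinuousOn (fun τ => K t τ (u τ)) J :=
  hK.comp_continuousOn (continuousOn_const.prodMk (continuousOn_id.prodMk hu))

theorem continuous_uncurry_volterra_integrand
    (hK : Continuous fun p : ℝ × ℝ × E => K p.1 p.2.1 p.2.2) (hu : Continuous u) :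
    Continuous (Function.uncurry fun t τ => K t τ (u τ)) :=
  hK.comp (continuous_fst.prodMk (continuous_snd.prodMk (hu.comp continuous_snd)))

theorem iccExtend_mem_closedBall (hab : a ≤ b) {z : E} {r : ℝ} {w : C(Icc a b, E)}
    (hw : w ∈ Metric.closedBall (ContinuousMap.const _ z) r) (τ : ℝ) :
    IccExtend hab w τ ∈ Metric.closedBall z r :=
  (ContinuousMap.dist_apply_le_dist (projIcc a b hab τ)).trans hw

variable [NormedSpace ℝ E]

/-- The right-hand side of the nonlinear Volterra equation
`u(t) = q(t) + ∫ₐᵗ K(t, τ, u(τ)) dτ`. -/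
def volterraMap (K : ℝ → ℝ → E → E) (q : ℝ → E) (a : ℝ) (u : ℝ → E) (t : ℝ) : E :=
  q t + ∫ τ in a..t, K t τ (u τ)

/-- A continuous solution on the time set `J` of the Volterra equation with kernel `K`, forcing
term `q` and initial time `a`. -/
def IsVolterraSolution (K : ℝ → ℝ → E → E) (q : ℝ → E) (a : ℝ) (J : Set ℝ) (u : ℝ → E) : Prop :=
  ContinuousOn u J ∧ EqOn u (volterraMap K q a u) J

theorem volterraMap_self (K : ℝ → ℝ → E → E) (q : ℝ → E) (a : ℝ) (u : ℝ → E) :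
    volterraMap K q a u a = q a := by
  rw [volterraMap, intervalIntegral.integral_same, add_zero]

theorem volterraMap_congr_eqOn {t : ℝ} (hat : a ≤ t) (h : EqOn u v (Ioo a t)) :
    volterraMap K q a u t = volterraMap K q a v t := by
  rw [volterraMap, volterraMap,
    intervalIntegral.integral_congr_Ioo_of_le hat fun τ hτ => by rw [h hτ]]

theorem IsVolterraSolution.mono {J J' : Set ℝ} (hu : IsVolterraSolution K q a J u)
    (h : J' ⊆ J) : IsVolterraSolution K q a J' u :=
  ⟨hu.1.mono h, hu.2.mono h⟩

theorem IsVolterraSolution.congr_eqOn {J : Set ℝ} (hu : IsVolterraSolution K q a J u)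
    (hJ : ∀ t ∈ J, a ≤ t ∧ Icc a t ⊆ J) (h : EqOn v u J) : IsVolterraSolution K q a J v :=
  ⟨hu.1.congr h, fun t ht => by
    rw [h ht, hu.2 ht, volterraMap_congr_eqOn (hJ t ht).1
      (h.mono (Ioo_subset_Icc_self.trans (hJ t ht).2))]⟩

theorem continuous_volterraMap (hK : Continuous fun p : ℝ × ℝ × E => K p.1 p.2.1 p.2.2)
    (hq : Continuous q) (hu : Continuous u) :
    Continuous (volterraMap K q a u) :=
  hq.add (intervalIntegral.continuous_parametric_intervalIntegral_of_continuous
    (continuous_uncurry_volterra_integrand hK hu) continuous_id)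

theorem dist_volterraMap_le (hK : Continuous fun p : ℝ × ℝ × E => K p.1 p.2.1 p.2.2) {t : ℝ}
    {L : ℝ≥0} (hat : a ≤ t) (hu : ContinuousOn u (Icc a t)) (hv : ContinuousOn v (Icc a t))
    (hL : ∀ τ ∈ Ioo a t, dist (K t τ (u τ)) (K t τ (v τ)) ≤ L * dist (u τ) (v τ)) :
    dist (volterraMap K q a u t) (volterraMap K q a v t) ≤ L * ∫ τ in a..t, dist (u τ) (v τ) := by
  have hdist : ContinuousOn (fun τ => dist (u τ) (v τ)) (Icc a t) :=
    continuous_dist.comp_continuousOn (hu.prodMk hv)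
  have hKu := continuousOn_volterra_integrand hK hu t
  have hKv := continuousOn_volterra_integrand hK hv t
  rw [volterraMap, volterraMap, dist_add_left, dist_eq_norm, ← intervalIntegral.integral_sub
    (hKu.intervalIntegrable_of_Icc hat) (hKv.intervalIntegrable_of_Icc hat),
    ← intervalIntegral.integral_const_mul]
  refine (intervalIntegral.norm_integral_le_integral_norm hat).trans ?_
  exact intervalIntegral.integral_mono_on_of_le_Ioo hat
    ((hKu.sub hKv).norm.intervalIntegrable_of_Icc hat)
    ((hdist.const_mul _).intervalIntegrable_of_Icc hat)
    fun τ hτ => by simpa only [dist_eq_norm] using hL τ hτ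

theorem forall_lt_of_forall_Ico_lt {g : ℝ → ℝ} {δ : ℝ} (hg : ContinuousOn g (Icc a b))
    (h : ∀ t ∈ Icc a b, (∀ τ ∈ Ico a t, g τ < δ) → g t < δ) : ∀ t ∈ Icc a b, g t < δ := by
  by_contra! hne
  have hcompact : IsCompact (Icc a b ∩ g ⁻¹' Ici δ) :=
    isCompact_Icc.of_isClosed_subset (hg.preimage_isClosed_of_isClosed isClosed_Icc isClosed_Ici)
      inter_subset_left
  obtain ⟨t, ht, hleast⟩ := hcompact.exists_isLeast hne
  refine (h t ht.1 fun τ hτ => ?_).not_ge ht.2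
  by_contra! hδ
  exact hτ.2.not_ge (hleast ⟨⟨hτ.1, hτ.2.le.trans ht.1.2⟩, hδ⟩)

namespace IsVolterraSolution

/-- The Lipschitz estimate is only assumed near `v`; up to the first time at which `u` could leave
the `δ`-neighbourhood of `v`, Grönwall's inequality applies and keeps `u` inside. -/
theorem dist_le_of_approx (hK : Continuous fun p : ℝ × ℝ × E => K p.1 p.2.1 p.2.2)
    (hu : IsVolterraSolution K q a (Icc a b) u) (hv : ContinuousOn v (Icc a b)) {δ ε : ℝ} {L : ℝ≥0}
    (hLip : ∀ τ ∈ Icc a b, ∀ z, dist z (v τ) < δ → ∀ t,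
      dist (K t τ z) (K t τ (v τ)) ≤ L * dist z (v τ))
    (happrox : ∀ t ∈ Icc a b, dist (volterraMap K q a v t) (v t) ≤ ε)
    (hεδ : ε * Real.exp (L * (b - a)) < δ) :
    ∀ t ∈ Icc a b, dist (u t) (v t) ≤ ε * Real.exp (L * (b - a)) := by
  have hdist : ContinuousOn (fun t => dist (u t) (v t)) (Icc a b) :=
    continuous_dist.comp_continuousOn (hu.1.prodMk hv)
  have gronwall : ∀ t ∈ Icc a b, (∀ τ ∈ Ico a t, dist (u τ) (v τ) < δ) →
      dist (u t) (v t) ≤ ε * Real.exp (L * (b - a)) := by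
    intro t ht hlt
    have hε : 0 ≤ ε := dist_nonneg.trans (happrox t ht)
    have hsub : Icc a t ⊆ Icc a b := Icc_subset_Icc_right ht.2
    have hle : ∀ s ∈ Icc a t, dist (u s) (v s) ≤ ε + L * ∫ τ in a..s, dist (u τ) (v τ) := by
      intro s hs
      have hsub' : Icc a s ⊆ Icc a b := (Icc_subset_Icc_right hs.2).trans hsub
      calc dist (u s) (v s) ≤ dist (volterraMap K q a v s) (v s) +
            dist (volterraMap K q a u s) (volterraMap K q a v s) := by
            rw [hu.2 (hsub hs), add_comm]
            exact dist_triangle _ _ _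
        _ ≤ ε + L * ∫ τ in a..s, dist (u τ) (v τ) := by
            refine add_le_add (happrox s (hsub hs)) (dist_volterraMap_le hK hs.1
              (hu.1.mono hsub') (hv.mono hsub') fun τ hτ => ?_)
            exact hLip τ (hsub' (Ioo_subset_Icc_self hτ)) _
              (hlt τ ⟨hτ.1.le, hτ.2.trans_le hs.2⟩) _
    calc dist (u t) (v t) ≤ ε * Real.exp (L * (t - a)) :=
          le_mul_exp_of_le_add_integral L.2 ((hdist.mono hsub).integrableOn_Icc) hle t
            (right_mem_Icc.2 ht.1)
      _ ≤ ε * Real.exp (L * (b - a)) := by gcongr; exact ht.2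
  have hlt := forall_lt_of_forall_Ico_lt hdist fun t ht h => (gronwall t ht h).trans_lt hεδ
  exact fun t ht => gronwall t ht fun τ hτ => hlt τ ⟨hτ.1, hτ.2.le.trans ht.2⟩

theorem eqOn (hK : Continuous fun p : ℝ × ℝ × E => K p.1 p.2.1 p.2.2)
    (hLip : UniformlyLocallyLipschitz fun i : ℝ × ℝ => K i.1 i.2)
    (hu : IsVolterraSolution K q a (Icc a b) u) (hv : IsVolterraSolution K q a (Icc a b) v) :
    EqOn u v (Icc a b) := by
  obtain ⟨L, δ, hδ, hL⟩ :=
    hLip.exists_dist_le_mul_of_isCompact (isCompact_Icc.image_of_continuousOn hv.1)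
  have hle := hu.dist_le_of_approx hK hv.1 (ε := 0) (L := L) (δ := δ)
    (fun τ hτ z hz t => hL (v τ) (mem_image_of_mem v hτ) z hz (t, τ))
    (fun t ht => by rw [← hv.2 ht, dist_self]) (by rwa [zero_mul])
  intro t ht
  simpa only [zero_mul, dist_le_zero] using hle t ht

theorem norm_le {c : ℝ≥0} (hgrow : ∀ t τ y, ‖K t τ y‖ ≤ c * (1 + ‖y‖))
    (hu : IsVolterraSolution K q a (Icc a b) u) {Q : ℝ} (hQ : ∀ t ∈ Icc a b, ‖q t‖ ≤ Q) :
    ∀ t ∈ Icc a b, ‖u t‖ ≤ (1 + Q) * Real.exp (c * (b - a)) := by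
  have hcont : ContinuousOn (fun t => 1 + ‖u t‖) (Icc a b) := continuousOn_const.add hu.1.norm
  have hle : ∀ t ∈ Icc a b, 1 + ‖u t‖ ≤ 1 + Q + c * ∫ τ in a..t, (1 + ‖u τ‖) := by
    intro t ht
    have hsub : Icc a t ⊆ Icc a b := Icc_subset_Icc_right ht.2
    have hint : ‖∫ τ in a..t, K t τ (u τ)‖ ≤ c * ∫ τ in a..t, (1 + ‖u τ‖) := by
      rw [← intervalIntegral.integral_const_mul]
      exact intervalIntegral.norm_integral_le_of_norm_le ht.1
        (ae_of_all _ fun τ _ => hgrow t τ (u τ))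
        (((hcont.mono hsub).const_mul _).intervalIntegrable_of_Icc ht.1)
    rw [add_assoc]
    gcongr
    rw [hu.2 ht]
    exact (norm_add_le _ _).trans (add_le_add (hQ t ht) hint)
  intro t ht
  have hQ0 : 0 ≤ Q := (norm_nonneg _).trans (hQ t ht)
  calc ‖u t‖ ≤ 1 + ‖u t‖ := le_add_of_nonneg_left zero_le_one
    _ ≤ (1 + Q) * Real.exp (c * (t - a)) :=
        le_mul_exp_of_le_add_integral c.2 hcont.integrableOn_Icc hle t ht
    _ ≤ (1 + Q) * Real.exp (c * (b - a)) := by gcongr; exact ht.2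

end IsVolterraSolution

/-- One step of the Picard iteration for the Volterra equation, as a map on the complete space
`C([a, b], E)`. -/
def picardMap (hK : Continuous fun p : ℝ × ℝ × E => K p.1 p.2.1 p.2.2) (hq : Continuous q)
    (hab : a ≤ b) (w : C(Icc a b, E)) : C(Icc a b, E) :=
  ⟨fun t => volterraMap K q a (IccExtend hab w) t,
    (continuous_volterraMap hK hq w.continuous.Icc_extend').comp continuous_subtype_val⟩

theorem mapsTo_picardMap_closedBall (hK : Continuous fun p : ℝ × ℝ × E => K p.1 p.2.1 p.2.2)
    (hq : Continuous q) (hab : a ≤ b) {z : E} {r M : ℝ} (hr : 0 ≤ r)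
    (hM : ∀ t τ, ∀ y ∈ Metric.closedBall z r, ‖K t τ y‖ ≤ M)
    (hqz : ∀ t ∈ Icc a b, dist (q t) z + M * (t - a) ≤ r) :
    MapsTo (picardMap hK hq hab) (Metric.closedBall (ContinuousMap.const _ z) r)
      (Metric.closedBall (ContinuousMap.const _ z) r) := by
  refine fun w hw => (ContinuousMap.dist_le hr).2 fun t => ?_
  have hint : ‖∫ τ in a..t, K t τ (IccExtend hab w τ)‖ ≤ M * (t - a) := by
    rw [← abs_of_nonneg (sub_nonneg.2 t.2.1)]
    exact intervalIntegral.norm_integral_le_of_norm_le_const fun τ _ =>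
      hM t τ _ (iccExtend_mem_closedBall hab hw τ)
  calc dist (q t + ∫ τ in a..t, K t τ (IccExtend hab w τ)) z
      ≤ dist (q t) z + ‖∫ τ in a..t, K t τ (IccExtend hab w τ)‖ := by
        rw [dist_eq_norm, dist_eq_norm, add_sub_right_comm]
        exact norm_add_le _ _
    _ ≤ dist (q t) z + M * (t - a) := by gcongr
    _ ≤ r := hqz t t.2

theorem lipschitzOnWith_picardMap_closedBall
    (hK : Continuous fun p : ℝ × ℝ × E => K p.1 p.2.1 p.2.2) (hq : Continuous q) (hab : a ≤ b)
    {z : E} {r : ℝ} {L : ℝ≥0} (hLip : ∀ t τ, LipschitzOnWith L (K t τ) (Metric.closedBall z r)) :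
    LipschitzOnWith (L * (b - a).toNNReal) (picardMap hK hq hab)
      (Metric.closedBall (ContinuousMap.const _ z) r) := by
  refine LipschitzOnWith.of_dist_le_mul fun w₁ h₁ w₂ h₂ => ?_
  refine (ContinuousMap.dist_le (by positivity)).2 fun t => ?_
  have hw₁ : Continuous (IccExtend hab w₁) := w₁.continuous.Icc_extend'
  have hw₂ : Continuous (IccExtend hab w₂) := w₂.continuous.Icc_extend'
  have hint : ∫ τ in a..t, dist (IccExtend hab w₁ τ) (IccExtend hab w₂ τ) ≤
      (t - a) * dist w₁ w₂ := by
    rw [← smul_eq_mul, ← intervalIntegral.integral_const]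
    exact intervalIntegral.integral_mono_on t.2.1 ((hw₁.dist hw₂).intervalIntegrable _ _)
      intervalIntegrable_const fun τ _ => ContinuousMap.dist_apply_le_dist _
  calc dist (volterraMap K q a (IccExtend hab w₁) t) (volterraMap K q a (IccExtend hab w₂) t)
      ≤ L * ∫ τ in a..t, dist (IccExtend hab w₁ τ) (IccExtend hab w₂ τ) :=
        dist_volterraMap_le hK t.2.1 hw₁.continuousOn hw₂.continuousOn fun τ _ =>
          (hLip t τ).dist_le_mul _ (iccExtend_mem_closedBall hab h₁ τ) _
            (iccExtend_mem_closedBall hab h₂ τ)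
    _ ≤ L * ((b - a) * dist w₁ w₂) := by
      gcongr
      exact hint.trans (by gcongr; exact t.2.2)
    _ = (L * (b - a).toNNReal : ℝ≥0) * dist w₁ w₂ := by
      rw [NNReal.coe_mul, Real.coe_toNNReal _ (sub_nonneg.2 hab), mul_assoc]

theorem exists_isVolterraSolution_of_lipschitzOnWith [CompleteSpace E]
    (hK : Continuous fun p : ℝ × ℝ × E => K p.1 p.2.1 p.2.2) (hq : Continuous q) (hab : a ≤ b)
    {z : E} {r M : ℝ} {L : ℝ≥0} (hr : 0 ≤ r)
    (hLip : ∀ t τ, LipschitzOnWith L (K t τ) (Metric.closedBall z r))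
    (hM : ∀ t τ, ∀ y ∈ Metric.closedBall z r, ‖K t τ y‖ ≤ M)
    (hqz : ∀ t ∈ Icc a b, dist (q t) z + M * (t - a) ≤ r) (hLb : L * (b - a) < 1) :
    ∃ u, IsVolterraSolution K q a (Icc a b) u := by
  have hmaps := mapsTo_picardMap_closedBall hK hq hab hr hM hqz
  have hcontr : ContractingWith (L * (b - a).toNNReal) (hmaps.restrict _ _ _) := by
    refine ⟨?_, (lipschitzOnWith_picardMap_closedBall hK hq hab hLip).mapsToRestrict hmaps⟩
    rwa [← NNReal.coe_lt_coe, NNReal.coe_mul, Real.coe_toNNReal _ (sub_nonneg.2 hab)]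
  obtain ⟨w, -, hfix, -⟩ := ContractingWith.exists_fixedPoint' Metric.isClosed_closedBall.isComplete
    hmaps hcontr (Metric.mem_closedBall_self hr) (edist_ne_top _ _)
  refine ⟨IccExtend hab w, w.continuous.Icc_extend'.continuousOn, fun t ht => ?_⟩
  rw [IccExtend_of_mem hab w ht]
  exact (DFunLike.congr_fun hfix ⟨t, ht⟩).symm

theorem exists_isVolterraSolution_nhds [CompleteSpace E]
    (hK : Continuous fun p : ℝ × ℝ × E => K p.1 p.2.1 p.2.2) (hq : Continuous q)
    (hLip : UniformlyLocallyLipschitz fun i : ℝ × ℝ => K i.1 i.2) {c : ℝ≥0}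
    (hgrow : ∀ t τ y, ‖K t τ y‖ ≤ c * (1 + ‖y‖)) (a : ℝ) :
    ∃ b > a, ∃ u, IsVolterraSolution K q a (Icc a b) u := by
  obtain ⟨L, r, hr, hL⟩ := hLip.exists_closedBall (q a)
  have hM : ∀ t τ, ∀ y ∈ Metric.closedBall (q a) r, ‖K t τ y‖ ≤ c * (1 + (‖q a‖ + r)) :=
    fun t τ y hy => (hgrow t τ y).trans (by gcongr; exact norm_le_of_mem_closedBall hy)
  have hsmall : ∀ᶠ t in 𝓝 a, dist (q t) (q a) + c * (1 + (‖q a‖ + r)) * (t - a) < r ∧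
      L * (t - a) < 1 := by
    refine ((Continuous.tendsto (by fun_prop) a).eventually_lt_const ?_).and
      ((Continuous.tendsto (by fun_prop) a).eventually_lt_const ?_)
    · simpa only [dist_self, sub_self, mul_zero, add_zero] using hr
    · simpa only [sub_self, mul_zero] using one_pos
  obtain ⟨b, hab, hb⟩ := mem_nhdsGE_iff_exists_Icc_subset.1 (mem_nhdsWithin_of_mem_nhds hsmall)
  exact ⟨b, hab, exists_isVolterraSolution_of_lipschitzOnWith hK hq hab.le hr.le
    (fun t τ => hL (t, τ)) hM (fun t ht => (hb ht).1.le) (hb (right_mem_Icc.2 hab.le)).2⟩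

theorem IsVolterraSolution.piecewise {c : ℝ}
    (hK : Continuous fun p : ℝ × ℝ × E => K p.1 p.2.1 p.2.2) (hab : a ≤ b)
    (hu : IsVolterraSolution K q a (Icc a b) u)
    (hv : IsVolterraSolution K (fun t => q t + ∫ τ in a..b, K t τ (u τ)) b (Icc b c) v) :
    IsVolterraSolution K q a (Icc a b ∪ Icc b c) ((Iic b).piecewise u v) := by
  set w := (Iic b).piecewise u v
  have hwu : EqOn w u (Icc a b) := fun t ht => piecewise_eq_of_mem _ _ _ ht.2
  have hwv : EqOn w v (Icc b c) := by
    intro t ht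
    rcases ht.1.eq_or_lt with rfl | hbt
    · rw [hwu (right_mem_Icc.2 hab), hu.2 (right_mem_Icc.2 hab), hv.2 ht, volterraMap_self]
      rfl
    · exact piecewise_eq_of_notMem _ _ _ hbt.not_ge
  refine ⟨(hu.1.congr hwu).union_of_isClosed (hv.1.congr hwv) isClosed_Icc isClosed_Icc, ?_⟩
  rintro t (ht | ht)
  · rw [hwu ht, hu.2 ht]
    exact volterraMap_congr_eqOn ht.1
      fun τ hτ => (hwu ⟨hτ.1.le, hτ.2.le.trans ht.2⟩).symm
  · have hint_u : ∫ τ in a..b, K t τ (u τ) = ∫ τ in a..b, K t τ (w τ) :=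
      intervalIntegral.integral_congr fun τ hτ => by
        rw [uIcc_of_le hab] at hτ
        simp only [hwu hτ]
    have hint_v : ∫ τ in b..t, K t τ (v τ) = ∫ τ in b..t, K t τ (w τ) :=
      intervalIntegral.integral_congr fun τ hτ => by
        rw [uIcc_of_le ht.1] at hτ
        simp only [hwv (Icc_subset_Icc_right ht.2 hτ)]
    rw [hwv ht, hv.2 ht, volterraMap, hint_u, hint_v, volterraMap, add_assoc,
      intervalIntegral.integral_add_adjacent_intervals]
    · exact (continuousOn_volterra_integrand hK (hu.1.congr hwu) t).intervalIntegrable_of_Icc hab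
    · exact ((continuousOn_volterra_integrand hK (hv.1.congr hwv) t).mono
        (Icc_subset_Icc_right ht.2)).intervalIntegrable_of_Icc ht.1

theorem IsVolterraSolution.exists_extension [CompleteSpace E]
    (hK : Continuous fun p : ℝ × ℝ × E => K p.1 p.2.1 p.2.2) (hq : Continuous q)
    (hLip : UniformlyLocallyLipschitz fun i : ℝ × ℝ => K i.1 i.2) {c : ℝ≥0}
    (hgrow : ∀ t τ y, ‖K t τ y‖ ≤ c * (1 + ‖y‖)) (hab : a ≤ b)
    (hu : IsVolterraSolution K q a (Icc a b) u) :
    ∃ b' > b, ∃ v, IsVolterraSolution K q a (Icc a b') v := by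
  set w := IccExtend hab ((Icc a b).domRestrict u)
  have hw : IsVolterraSolution K q a (Icc a b) w :=
    hu.congr_eqOn (fun t ht => ⟨ht.1, Icc_subset_Icc_right ht.2⟩)
      fun t ht => IccExtend_of_mem hab _ ht
  have hq' : Continuous fun t => q t + ∫ τ in a..b, K t τ (w τ) :=
    hq.add (intervalIntegral.continuous_parametric_intervalIntegral_of_continuous'
      (continuous_uncurry_volterra_integrand hK hu.1.domRestrict.Icc_extend') a b)
  obtain ⟨b', hb, v, hv⟩ := exists_isVolterraSolution_nhds hK hq' hLip hgrow b
  refine ⟨b', hb, (Iic b).piecewise w v, ?_⟩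
  rw [← Icc_union_Icc_eq_Icc hab hb.le]
  exact hw.piecewise hK hab hv

theorem exists_isVolterraSolution_of_forall_Icc
    (hK : Continuous fun p : ℝ × ℝ × E => K p.1 p.2.1 p.2.2)
    (hLip : UniformlyLocallyLipschitz fun i : ℝ × ℝ => K i.1 i.2) {J : Set ℝ}
    (hJ : ∀ t ∈ J, a ≤ t ∧ Icc a t ⊆ J ∧ ∃ s ∈ J, t < s)
    (h : ∀ t ∈ J, ∃ u, IsVolterraSolution K q a (Icc a t) u) :
    ∃ u, IsVolterraSolution K q a J u := by
  choose! U hU using h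
  have heq : ∀ t ∈ J, EqOn (fun s => U s s) (U t) (Icc a t) := fun t ht s hs =>
    ((hU s ((hJ t ht).2.1 hs)).eqOn hK hLip ((hU t ht).mono (Icc_subset_Icc_right hs.2)))
      (right_mem_Icc.2 hs.1)
  have hsol : ∀ t ∈ J, IsVolterraSolution K q a (Icc a t) fun s => U s s := fun t ht =>
    (hU t ht).congr_eqOn (fun s hs => ⟨hs.1, Icc_subset_Icc_right hs.2⟩) (heq t ht)
  refine ⟨fun s => U s s, fun t ht => ?_, fun t ht => (hsol t ht).2 (right_mem_Icc.2 (hJ t ht).1)⟩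
  obtain ⟨hat, -, s, hs, hts⟩ := hJ t ht
  refine ((hsol s hs).1 t ⟨hat, hts.le⟩).mono_of_mem_nhdsWithin ?_
  filter_upwards [self_mem_nhdsWithin, mem_nhdsWithin_of_mem_nhds (Iic_mem_nhds hts)] with r hr hrs
  exact ⟨(hJ r hr).1, hrs⟩

theorem continuous_volterraMap_of_bounded
    (hK : Continuous fun p : ℝ × ℝ × E => K p.1 p.2.1 p.2.2) (hq : Continuous q)
    (hu : AEStronglyMeasurable u) {M : ℝ} (hM : ∀ t τ, ‖K t τ (u τ)‖ ≤ M) :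
    Continuous (volterraMap K q a u) := by
  refine hq.add (continuous_iff_continuousAt.2 fun t => ?_)
  have hprim : ContinuousAt (fun p : ℝ × ℝ => ∫ τ in a..p.2, K p.1 τ (u τ)) (t, t) := by
    refine intervalIntegral.continuousAt_parametric_primitive_of_dominated (fun _ => M)
      (min a t - 1) (max a t + 1) (fun s => ?_)
      (Eventually.of_forall fun s => ae_of_all _ fun τ => hM s τ) intervalIntegrable_const
      (ae_of_all _ fun τ => (hK.comp (by fun_prop : Continuous fun s : ℝ =>
        (s, τ, u τ))).continuousAt) ?_ ?_ (measure_singleton t)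
    · exact (hK.comp_aestronglyMeasurable (aestronglyMeasurable_const.prodMk
        (aestronglyMeasurable_id.prodMk hu))).restrict
    · exact ⟨(sub_one_lt _).trans_le (min_le_left a t), (le_max_left a t).trans_lt (lt_add_one _)⟩
    · exact ⟨(sub_one_lt _).trans_le (min_le_right a t), (le_max_right a t).trans_lt (lt_add_one _)⟩
  exact hprim.comp (f := fun s : ℝ => (s, s)) (by fun_prop)

theorem IsVolterraSolution.exists_norm_le_of_Ico (hq : Continuous q) {c : ℝ≥0}
    (hgrow : ∀ t τ y, ‖K t τ y‖ ≤ c * (1 + ‖y‖)) (hu : IsVolterraSolution K q a (Ico a b) u) :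
    ∃ M ≥ 0, ∀ t ∈ Ico a b, ‖u t‖ ≤ M := by
  obtain ⟨Q, hQ⟩ := (isCompact_Icc (a := a) (b := b)).exists_bound_of_continuousOn hq.continuousOn
  refine ⟨(1 + max Q 0) * Real.exp (c * (b - a)), by positivity, fun t ht => ?_⟩
  have hsub : Icc a t ⊆ Ico a b := Icc_subset_Ico_right ht.2
  refine ((hu.mono hsub).norm_le hgrow (fun s hs => (hQ s (Ico_subset_Icc_self (hsub hs))).trans
    (le_max_left Q 0)) t (right_mem_Icc.2 ht.1)).trans ?_
  gcongr
  exact ht.2.le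

theorem IsVolterraSolution.exists_Icc_of_Ico
    (hK : Continuous fun p : ℝ × ℝ × E => K p.1 p.2.1 p.2.2) (hq : Continuous q) {c : ℝ≥0}
    (hgrow : ∀ t τ y, ‖K t τ y‖ ≤ c * (1 + ‖y‖)) (hu : IsVolterraSolution K q a (Ico a b) u) :
    ∃ v, IsVolterraSolution K q a (Icc a b) v := by
  obtain ⟨M, hM0, hM⟩ := hu.exists_norm_le_of_Ico hq hgrow
  let φ := (Ico a b).indicator u
  have hφ_meas : AEStronglyMeasurable φ :=
    (aestronglyMeasurable_indicator_iff measurableSet_Ico).2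
      (hu.1.aestronglyMeasurable measurableSet_Ico)
  have hφ_norm : ∀ τ, ‖φ τ‖ ≤ M := by
    intro τ
    simp only [φ, norm_indicator_eq_indicator_norm]
    exact indicator_le' hM (fun _ _ => hM0) τ
  have hφu : EqOn φ u (Ico a b) := eqOn_indicator
  have hφ_eq : EqOn φ (volterraMap K q a φ) (Ico a b) := fun t ht => by
    rw [hφu ht, hu.2 ht]
    exact volterraMap_congr_eqOn ht.1 fun τ hτ => (hφu ⟨hτ.1.le, hτ.2.trans ht.2⟩).symm
  refine ⟨volterraMap K q a φ, (continuous_volterraMap_of_bounded hK hq hφ_meas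
    (M := c * (1 + M)) fun t τ => (hgrow t τ _).trans ?_).continuousOn, fun t ht => ?_⟩
  · gcongr
    exact hφ_norm τ
  · exact volterraMap_congr_eqOn ht.1 fun τ hτ => hφ_eq ⟨hτ.1.le, hτ.2.trans_le ht.2⟩

theorem exists_isVolterraSolution_Icc [CompleteSpace E]
    (hK : Continuous fun p : ℝ × ℝ × E => K p.1 p.2.1 p.2.2) (hq : Continuous q)
    (hLip : UniformlyLocallyLipschitz fun i : ℝ × ℝ => K i.1 i.2) {c : ℝ≥0}
    (hgrow : ∀ t τ y, ‖K t τ y‖ ≤ c * (1 + ‖y‖)) (hab : a ≤ b) :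
    ∃ u, IsVolterraSolution K q a (Icc a b) u := by
  let s : Set ℝ := {t | ∃ u, IsVolterraSolution K q a (Icc a t) u}
  have hmono : ∀ t ∈ s, ∀ t' ≤ t, t' ∈ s := fun t ⟨u, hu⟩ t' ht' =>
    ⟨u, hu.mono (Icc_subset_Icc_right ht')⟩
  have ha : a ∈ s := by
    obtain ⟨t, hat, ht⟩ := exists_isVolterraSolution_nhds hK hq hLip hgrow a
    exact hmono t ht a hat.le
  have hclosed : IsClosed (s ∩ Icc a b) := by
    refine isClosed_of_closure_subset fun t ht => ?_
    have htI : t ∈ Icc a b := isClosed_Icc.closure_subset (closure_mono inter_subset_right ht)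
    have hlt : ∀ t' ∈ Ico a t, t' ∈ s := by
      intro t' ht'
      obtain ⟨r, hr, hrs⟩ := mem_closure_iff.1 ht (Ioi t') isOpen_Ioi ht'.2
      exact hmono r hrs.1 t' hr.le
    have hIco : ∀ t' ∈ Ico a t, a ≤ t' ∧ Icc a t' ⊆ Ico a t ∧ ∃ r ∈ Ico a t, t' < r := by
      intro t' ht'
      obtain ⟨r, htr, hrt⟩ := exists_between ht'.2
      exact ⟨ht'.1, Icc_subset_Ico_right ht'.2, r, ⟨ht'.1.trans htr.le, hrt⟩, htr⟩
    obtain ⟨u, hu⟩ := exists_isVolterraSolution_of_forall_Icc hK hLip hIco hlt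
    exact ⟨hu.exists_Icc_of_Ico hK hq hgrow, htI⟩
  refine hclosed.Icc_subset_of_forall_exists_gt ha (fun t ht y hy => ?_) (right_mem_Icc.2 hab)
  obtain ⟨u, hu⟩ := ht.1
  obtain ⟨t', htt', ht'⟩ := hu.exists_extension hK hq hLip hgrow ht.2.1
  exact ⟨min t' y, hmono t' ht' _ (min_le_left _ _), lt_min htt' hy, min_le_right _ _⟩

theorem exists_isVolterraSolution_Ici [CompleteSpace E]
    (hK : Continuous fun p : ℝ × ℝ × E => K p.1 p.2.1 p.2.2) (hq : Continuous q)
    (hLip : UniformlyLocallyLipschitz fun i : ℝ × ℝ => K i.1 i.2) {c : ℝ≥0}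
    (hgrow : ∀ t τ y, ‖K t τ y‖ ≤ c * (1 + ‖y‖)) (a : ℝ) :
    ∃ u, IsVolterraSolution K q a (Ici a) u :=
  exists_isVolterraSolution_of_forall_Icc hK hLip
    (fun t ht => ⟨ht, Icc_subset_Ici_self, t + 1, ht.trans (lt_add_one t).le, lt_add_one t⟩)
    fun _ ht => exists_isVolterraSolution_Icc hK hq hLip hgrow ht

theorem continuous_uncurry_volterraMap {X : Type*} [TopologicalSpace X] {K : X → ℝ → ℝ → E → E}
    {q : X → ℝ → E} (hK : Continuous fun p : X × ℝ × ℝ × E => K p.1 p.2.1 p.2.2.1 p.2.2.2)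
    (hq : Continuous fun p : X × ℝ => q p.1 p.2) (hu : Continuous u) :
    Continuous fun p : X × ℝ => volterraMap (K p.1) (q p.1) a u p.2 :=
  hq.add (intervalIntegral.continuous_parametric_intervalIntegral_of_continuous
    (f := fun (p : X × ℝ) τ => K p.1 p.2 τ (u τ))
    (hK.comp (by fun_prop : Continuous fun r : (X × ℝ) × ℝ => (r.1.1, r.1.2, r.2, u r.2)))
    continuous_snd)

theorem continuous_volterraSolution {X : Type*} [TopologicalSpace X] {K : X → ℝ → ℝ → E → E}
    {q : X → ℝ → E} (hK : Continuous fun p : X × ℝ × ℝ × E => K p.1 p.2.1 p.2.2.1 p.2.2.2)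
    (hq : Continuous fun p : X × ℝ => q p.1 p.2)
    (hLip : UniformlyLocallyLipschitz fun i : X × ℝ × ℝ => K i.1 i.2.1 i.2.2) (hab : a ≤ b)
    {u : X → C(Icc a b, E)}
    (hu : ∀ p, IsVolterraSolution (K p) (q p) a (Icc a b) (IccExtend hab (u p))) :
    Continuous u := by
  refine continuous_iff_continuousAt.2 fun p₀ => ?_
  set v := IccExtend hab (u p₀)
  have hv : Continuous v := (u p₀).continuous.Icc_extend'
  let w : C(X, C(Icc a b, E)) := ContinuousMap.curry
    ⟨fun r : X × Icc a b => volterraMap (K r.1) (q r.1) a v r.2,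
      (continuous_uncurry_volterraMap hK hq hv).comp
        (continuous_fst.prodMk (continuous_subtype_val.comp continuous_snd))⟩
  have hw : w p₀ = u p₀ := by
    ext t
    exact ((hu p₀).2 t.2).symm.trans (IccExtend_of_mem hab (u p₀) t.2)
  have hsol : ∀ p t, u p t = IccExtend hab (u p) t := fun p t =>
    (IccExtend_of_mem hab (u p) t.2).symm
  obtain ⟨L, δ, hδ, hL⟩ :=
    hLip.exists_dist_le_mul_of_isCompact ((isCompact_Icc (a := a) (b := b)).image hv)
  have hη : Tendsto (fun p => dist (w p) (w p₀) * Real.exp (L * (b - a))) (𝓝 p₀) (𝓝 0) := by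
    simpa only [dist_self, zero_mul] using
      ((w.continuous.tendsto p₀).dist (tendsto_const_nhds (x := w p₀))).mul_const _
  refine tendsto_iff_dist_tendsto_zero.2
    (squeeze_zero' (Eventually.of_forall fun _ => dist_nonneg) ?_ hη)
  filter_upwards [hη.eventually_lt_const hδ] with p hp
  refine (ContinuousMap.dist_le (by positivity)).2 fun t => ?_
  rw [hsol, hsol]
  refine (hu p).dist_le_of_approx (hK.comp (by fun_prop : Continuous fun r : ℝ × ℝ × E =>
    (p, r))) hv.continuousOn (fun τ hτ z hz s => hL _ (mem_image_of_mem v hτ) z hz (p, s, τ))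
    (fun s hs => ?_) hp t t.2
  rw [hw, show v s = u p₀ ⟨s, hs⟩ from IccExtend_of_mem hab (u p₀) hs]
  exact ContinuousMap.dist_apply_le_dist (f := w p) ⟨s, hs⟩

end Volterra

section MeasureOfNoncompactness

variable {E : Type*} [NormedAddCommGroup E] {ι : Type*}

theorem hausdorffMNC_le_of_subset_biUnion_ball {Ω s : Set E} {r : ℝ} (hr : 0 < r) (hs : s.Finite)
    (h : Ω ⊆ ⋃ c ∈ s, Metric.ball c r) : hausdorffMNC Ω ≤ ENNReal.ofReal r :=
  iInf₂_le r ⟨hr, s, hs, h⟩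

theorem hausdorffMNC_mono {Ω Ω' : Set E} (h : Ω ⊆ Ω') : hausdorffMNC Ω ≤ hausdorffMNC Ω' :=
  le_iInf₂ fun _ ⟨hr, _, hs, hs'⟩ => hausdorffMNC_le_of_subset_biUnion_ball hr hs (h.trans hs')

theorem hausdorffMNC_le_of_forall_norm_le {Ω : Set E} {M : ℝ} (h : ∀ x ∈ Ω, ‖x‖ ≤ M) :
    hausdorffMNC Ω ≤ ENNReal.ofReal (max (M + 1) 1) := by
  refine hausdorffMNC_le_of_subset_biUnion_ball (by positivity) (finite_singleton (0 : E))
    fun x hx => ?_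
  simp only [mem_singleton_iff, iUnion_iUnion_eq_left, mem_ball_zero_iff]
  exact ((h x hx).trans_lt (lt_add_one M)).trans_le (le_max_left _ _)

theorem hausdorffMNC_le_of_forall_infEDist_le {Ω C : Set E} {r : ℝ≥0∞} (hC : IsCompact C)
    (h : ∀ x ∈ Ω, Metric.infEDist x C ≤ r) : hausdorffMNC Ω ≤ r := by
  refine ENNReal.le_of_forall_pos_le_add fun ε hε hr => ?_
  lift r to ℝ≥0 using hr.ne
  have hε2 : 0 < ε / 2 := half_pos hε
  obtain ⟨s, hs, hCs⟩ := Metric.totallyBounded_iff.1 hC.totallyBounded (ε / 2 : ℝ≥0)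
    (NNReal.coe_pos.2 hε2)
  rw [← ENNReal.coe_add, ← ENNReal.ofReal_coe_nnreal]
  refine hausdorffMNC_le_of_subset_biUnion_ball (by positivity) hs fun x hx => ?_
  obtain ⟨y, hy, hxy⟩ : ∃ y ∈ C, edist x y < (r + ε / 2 : ℝ≥0) := Metric.infEDist_lt_iff.1
    ((h x hx).trans_lt (ENNReal.coe_lt_coe.2 (lt_add_of_pos_right r hε2)))
  obtain ⟨z, hz, hyz⟩ := mem_iUnion₂.1 (hCs hy)
  refine mem_iUnion₂.2 ⟨z, hz, Metric.mem_ball.2 ?_⟩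
  calc dist x z ≤ dist x y + dist y z := dist_triangle x y z
    _ < (r + ε / 2 : ℝ≥0) + (ε / 2 : ℝ≥0) :=
      add_lt_add (edist_lt_coe.1 hxy) (Metric.mem_ball.1 hyz)
    _ = (r + ε : ℝ≥0) := by rw [← NNReal.coe_add, add_assoc, add_halves]

theorem hausdorffMNC_range_add_le (x y : ι → E) :
    hausdorffMNC (range fun i => x i + y i) ≤ hausdorffMNC (range x) + hausdorffMNC (range y) := by
  refine ENNReal.le_iInf_add_iInf fun r r' => ENNReal.le_iInf_add_iInf ?_
  rintro ⟨hr, s, hs, h⟩ ⟨hr', s', hs', h'⟩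
  rw [← ENNReal.ofReal_add hr.le hr'.le]
  refine hausdorffMNC_le_of_subset_biUnion_ball (add_pos hr hr') (hs.image2 (· + ·) hs') ?_
  rintro _ ⟨i, rfl⟩
  obtain ⟨c, hc, hcr⟩ := mem_iUnion₂.1 (h (mem_range_self i))
  obtain ⟨c', hc', hcr'⟩ := mem_iUnion₂.1 (h' (mem_range_self i))
  refine mem_iUnion₂.2 ⟨c + c', mem_image2_of_mem hc hc', ?_⟩
  exact (dist_add_add_le _ _ _ _).trans_lt (add_lt_add hcr hcr')

theorem hausdorffMNC_image2_univ_le_mul {X : Type*} [TopologicalSpace X] [CompactSpace X]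
    {L : X → E → E} {a : ℝ≥0} (ha : a ≠ 0) (hL : ∀ l, LipschitzWith a (L l))
    (hLc : ∀ y, Continuous fun l => L l y) (Ω : Set E) :
    hausdorffMNC (image2 L univ Ω) ≤ a * hausdorffMNC Ω := by
  have ha' : (a : ℝ≥0∞) ≠ 0 := ENNReal.coe_ne_zero.2 ha
  rw [hausdorffMNC.eq_1 Ω, ENNReal.mul_iInf_of_ne ha' ENNReal.coe_ne_top]
  refine le_iInf fun r => ?_
  rw [ENNReal.mul_iInf_of_ne ha' ENNReal.coe_ne_top]
  refine le_iInf fun ⟨_, s, hs, hΩ⟩ => ?_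
  have hC : IsCompact (⋃ c ∈ s, range fun l => L l c) :=
    hs.isCompact_biUnion fun c _ => isCompact_range (hLc c)
  refine hausdorffMNC_le_of_forall_infEDist_le hC ?_
  rintro _ ⟨l, -, y, hy, rfl⟩
  obtain ⟨c, hc, hyc⟩ := mem_iUnion₂.1 (hΩ hy)
  calc Metric.infEDist (L l y) (⋃ c ∈ s, range fun l => L l c) ≤ edist (L l y) (L l c) :=
        Metric.infEDist_le_edist_of_mem (mem_iUnion₂.2 ⟨c, hc, mem_range_self l⟩)
    _ ≤ a * edist y c := hL l y c
    _ ≤ a * ENNReal.ofReal r := by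
        gcongr
        rw [edist_dist]
        exact ENNReal.ofReal_le_ofReal (Metric.mem_ball.1 hyc).le

theorem measurable_iSup_infEDist {α : Type*} [TopologicalSpace α] [MeasurableSpace α]
    [OpensMeasurableSpace α] {f : ι → α → E} (hf : ∀ i, Continuous (f i)) (s : Set E) :
    Measurable fun τ => ⨆ i, Metric.infEDist (f i τ) s :=
  (lowerSemicontinuous_iSup fun i =>
    (Metric.continuous_infEDist.comp (hf i)).lowerSemicontinuous).measurable

variable [NormedSpace ℝ E]

theorem hausdorffMNC_range_le_iSup_infEDist {x : ι → E} {M : ℝ} (hx : ∀ i, ‖x i‖ ≤ M)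
    (V : Submodule ℝ E) [FiniteDimensional ℝ V] :
    hausdorffMNC (range x) ≤ ⨆ i, Metric.infEDist (x i) (V : Set E) := by
  refine le_of_forall_gt_imp_ge_of_dense fun r hr => ?_
  rcases eq_or_ne r ∞ with rfl | hr'
  · exact le_top
  lift r to ℝ≥0 using hr'
  have hC : IsCompact ((↑) '' Metric.closedBall (0 : V) (M + r) : Set E) :=
    (isCompact_closedBall _ _).image continuous_subtype_val
  refine hausdorffMNC_le_of_forall_infEDist_le hC ?_
  rintro _ ⟨i, rfl⟩
  obtain ⟨y, hy, hxy⟩ := Metric.infEDist_lt_iff.1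
    ((le_iSup (fun i => Metric.infEDist (x i) (V : Set E)) i).trans_lt hr)
  refine (Metric.infEDist_le_edist_of_mem (mem_image_of_mem _ (x := ⟨y, hy⟩) ?_)).trans hxy.le
  refine mem_closedBall_zero_iff.2 ((norm_le_norm_add_norm_sub' y (x i)).trans ?_)
  rw [← dist_eq_norm, dist_comm]
  exact add_le_add (hx i) (edist_lt_coe.1 hxy).le

theorem infEDist_submodule_eq_enorm_mkQL (V : Submodule ℝ E) (x : E) :
    Metric.infEDist x (V : Set E) = ‖V.mkQL x‖ₑ := by
  have h : ‖V.mkQL x‖ = Metric.infDist x (V : Set E) :=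
    QuotientAddGroup.norm_mk (S := V.toAddSubgroup) x
  rw [← ofReal_norm, h, Metric.infDist,
    ENNReal.ofReal_toReal (Metric.infEDist_ne_top ⟨0, V.zero_mem⟩)]

theorem infEDist_integral_le_lintegral_infEDist [CompleteSpace E] {α : Type*} [MeasurableSpace α]
    {μ : Measure α} {f : α → E} (hf : Integrable f μ) {V : Submodule ℝ E}
    (hV : IsClosed (V : Set E)) :
    Metric.infEDist (∫ τ, f τ ∂μ) (V : Set E) ≤ ∫⁻ τ, Metric.infEDist (f τ) (V : Set E) ∂μ := by
  simp only [infEDist_submodule_eq_enorm_mkQL]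
  rw [← V.mkQL.integral_comp_comm hf]
  exact enorm_integral_le_lintegral_enorm _

section Separable

variable [TopologicalSpace.SeparableSpace E]

variable (E) in
/-- An increasing sequence of finite-dimensional subspaces with dense union. -/
def exhaustingSubspace (m : ℕ) : Submodule ℝ E :=
  Submodule.span ℝ (TopologicalSpace.denseSeq E '' Iio m)

theorem exhaustingSubspace_mono : Monotone (exhaustingSubspace E) := fun _ _ h =>
  Submodule.span_mono (image_mono (Iio_subset_Iio h))

instance finiteDimensional_exhaustingSubspace (m : ℕ) :
    FiniteDimensional ℝ (exhaustingSubspace E m) :=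
  FiniteDimensional.span_of_finite ℝ ((finite_Iio m).image _)

theorem eventually_infEDist_exhaustingSubspace_lt (x : E) {ε : ℝ≥0∞} (hε : 0 < ε) :
    ∀ᶠ m in atTop, Metric.infEDist x (exhaustingSubspace E m : Set E) < ε := by
  obtain ⟨_, ⟨i, rfl⟩, hi⟩ :=
    EMetric.mem_closure_iff.1 (TopologicalSpace.denseRange_denseSeq E x) ε hε
  filter_upwards [eventually_gt_atTop i] with m hm
  exact Metric.infEDist_lt_iff.2 ⟨_, Submodule.subset_span (mem_image_of_mem _ hm), hi⟩

theorem hausdorffMNC_range_eq_iInf_iSup_infEDist {x : ι → E} {M : ℝ} (hx : ∀ i, ‖x i‖ ≤ M) :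
    hausdorffMNC (range x) =
      ⨅ m, ⨆ i, Metric.infEDist (x i) (exhaustingSubspace E m : Set E) := by
  refine le_antisymm (le_iInf fun m => hausdorffMNC_range_le_iSup_infEDist hx _) ?_
  refine le_iInf₂ fun r ⟨_, s, hs, h⟩ => ENNReal.le_of_forall_pos_le_add fun ε hε _ => ?_
  obtain ⟨m, hm⟩ := ((eventually_all_finite hs).2 fun c _ =>
    eventually_infEDist_exhaustingSubspace_lt c (ENNReal.coe_pos.2 hε)).exists
  refine iInf_le_of_le m (iSup_le fun i => ?_)
  obtain ⟨c, hc, hcr⟩ := mem_iUnion₂.1 (h (mem_range_self i))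
  refine Metric.infEDist_le_edist_add_infEDist.trans (add_le_add ?_ (hm c hc).le)
  rw [edist_dist]
  exact ENNReal.ofReal_le_ofReal (Metric.mem_ball.1 hcr).le

variable {α : Type*} [TopologicalSpace α] [MeasurableSpace α] [OpensMeasurableSpace α]
  {f : ι → α → E} {M : ℝ}

theorem measurable_hausdorffMNC_range (hf : ∀ i, Continuous (f i)) (hM : ∀ i τ, ‖f i τ‖ ≤ M) :
    Measurable fun τ => hausdorffMNC (range fun i => f i τ) := by
  simp only [fun τ => hausdorffMNC_range_eq_iInf_iSup_infEDist fun i => hM i τ]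
  exact Measurable.iInf fun m => measurable_iSup_infEDist hf _

theorem hausdorffMNC_range_integral_le [CompleteSpace E] (μ : Measure α) [IsFiniteMeasure μ]
    (hf : ∀ i, Continuous (f i)) (hM : ∀ i τ, ‖f i τ‖ ≤ M) :
    hausdorffMNC (range fun i => ∫ τ, f i τ ∂μ) ≤
      ∫⁻ τ, hausdorffMNC (range fun i => f i τ) ∂μ := by
  have hint : ∀ i, Integrable (f i) μ := fun i =>
    Integrable.of_bound (hf i).aestronglyMeasurable M (ae_of_all _ (hM i))
  have hbound : ∀ i, ‖∫ τ, f i τ ∂μ‖ ≤ M * μ.real univ := fun i =>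
    norm_integral_le_of_norm_le_const (ae_of_all _ (hM i))
  simp only [hausdorffMNC_range_eq_iInf_iSup_infEDist hbound,
    fun τ => hausdorffMNC_range_eq_iInf_iSup_infEDist fun i => hM i τ]
  rw [lintegral_iInf fun m => measurable_iSup_infEDist hf _]
  · refine iInf_mono fun m => iSup_le fun i => (infEDist_integral_le_lintegral_infEDist (hint i)
      (exhaustingSubspace E m).closed_of_finiteDimensional).trans ?_
    exact lintegral_mono fun τ =>
      le_iSup (fun i => Metric.infEDist (f i τ) (exhaustingSubspace E m : Set E)) i
  · exact fun m n hmn τ => iSup_mono fun i => Metric.infEDist_anti (exhaustingSubspace_mono hmn)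
  · have hle : ∀ τ, ⨆ i, Metric.infEDist (f i τ) (exhaustingSubspace E 0 : Set E) ≤
        ENNReal.ofReal M := fun τ => iSup_le fun i => by
      refine (Metric.infEDist_le_edist_of_mem (exhaustingSubspace E 0).zero_mem).trans ?_
      rw [edist_dist, dist_zero_right]
      exact ENNReal.ofReal_le_ofReal (hM i τ)
    refine ne_top_of_le_ne_top ?_ (lintegral_mono hle)
    rw [lintegral_const]
    exact ENNReal.mul_ne_top ENNReal.ofReal_ne_top (measure_ne_top μ univ)

theorem hausdorffMNC_range_volterraSolution_le [CompleteSpace E] {K : ι → ℝ → ℝ → E → E}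
    {q u : ι → ℝ → E} {B : ℝ≥0∞} {N k ω a b : ℝ} (hk : 0 ≤ k)
    (hK : ∀ i, Continuous fun p : ℝ × ℝ × E => K i p.1 p.2.1 p.2.2)
    (hu : ∀ i, IsVolterraSolution (K i) (q i) a (Icc a b) (u i)) (hcont : ∀ i, Continuous (u i))
    (hM : ∀ i τ, ‖u i τ‖ ≤ M) (hN : ∀ i t τ, ‖K i t τ (u i τ)‖ ≤ N)
    (hq : ∀ t ∈ Icc a b, hausdorffMNC (range fun i => q i t) ≤
      ENNReal.ofReal (Real.exp (-ω * (t - a))) * B)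
    (hKβ : ∀ t, ∀ τ ≤ t, hausdorffMNC (range fun i => K i t τ (u i τ)) ≤
      ENNReal.ofReal (Real.exp (-ω * (t - τ))) *
        (ENNReal.ofReal k * hausdorffMNC (range fun i => u i τ))) :
    ∀ t ∈ Icc a b, hausdorffMNC (range fun i => u i t) ≤
      ENNReal.ofReal (Real.exp ((k - ω) * (t - a))) * B := by
  have hfin : ∫⁻ τ in Icc a b, hausdorffMNC (range fun i => u i τ) ≠ ∞ := by
    refine ne_top_of_le_ne_top ?_ (lintegral_mono fun τ =>
      hausdorffMNC_le_of_forall_norm_le (forall_mem_range.2 fun i => hM i τ))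
    rw [setLIntegral_const]
    exact ENNReal.mul_ne_top ENNReal.ofReal_ne_top measure_Icc_lt_top.ne
  refine le_mul_exp_of_le_exp_mul_add_lintegral hk (measurable_hausdorffMNC_range hcont hM) hfin
    fun t ht => ?_
  have hut : (fun i => u i t) = fun i => q i t + ∫ τ in Icc a t, K i t τ (u i τ) := by
    funext i
    rw [(hu i).2 ht, volterraMap, intervalIntegral.integral_of_le ht.1,
      integral_Icc_eq_integral_Ioc]
  rw [hut]
  refine (hausdorffMNC_range_add_le _ _).trans (add_le_add (hq t ht) ?_)
  refine (hausdorffMNC_range_integral_le (M := N) (volume.restrict (Icc a t))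
    (fun i => (continuous_uncurry_volterra_integrand (hK i) (hcont i)).comp
      (continuous_const.prodMk continuous_id)) fun i τ => hN i t τ).trans ?_
  exact setLIntegral_mono' measurableSet_Icc fun τ hτ => hKβ t τ hτ.2

end Separable

end MeasureOfNoncompactness

section Semigroup

variable {E : Type*} [NormedAddCommGroup E] [NormedSpace ℝ E] {S : ℝ → E →L[ℝ] E} {ω : ℝ}

/-- The extension of a semigroup to all real times which is the identity for negative times. With it
the integrand `S(t - τ) f(τ)` is continuous in `(t, τ)` also where `t < τ`. -/
def extendSemigroup (S : ℝ → E →L[ℝ] E) (t : ℝ) : E →L[ℝ] E := S (max t 0)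

theorem extendSemigroup_of_nonneg {t : ℝ} (ht : 0 ≤ t) : extendSemigroup S t = S t := by
  rw [extendSemigroup, max_eq_left ht]

namespace IsC0Semigroup

theorem apply_apply (hS : IsC0Semigroup S) {s t : ℝ} (hs : 0 ≤ s) (ht : 0 ≤ t) (x : E) :
    S s (S t x) = S (s + t) x := by
  rw [hS.map_add s t hs ht, ContinuousLinearMap.comp_apply]

theorem extendSemigroup_zero (hS : IsC0Semigroup S) (x : E) : extendSemigroup S 0 x = x := by
  rw [extendSemigroup_of_nonneg le_rfl, hS.map_zero, ContinuousLinearMap.id_apply]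

theorem norm_apply_sub_apply_le (hS : IsC0Semigroup S) (hS₁ : ∀ t, 0 ≤ t → ‖S t‖ ≤ 1)
    {s t : ℝ} (hs : 0 ≤ s) (ht : 0 ≤ t) (x : E) : ‖S t x - S s x‖ ≤ ‖S |t - s| x - x‖ := by
  wlog hst : s ≤ t generalizing s t
  · rw [norm_sub_rev, abs_sub_comm]
    exact this ht hs (le_of_not_ge hst)
  rw [abs_of_nonneg (sub_nonneg.2 hst)]
  calc ‖S t x - S s x‖ = ‖S s (S (t - s) x - x)‖ := by
        rw [map_sub, hS.apply_apply hs (sub_nonneg.2 hst), add_sub_cancel]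
    _ ≤ 1 * ‖S (t - s) x - x‖ := (S s).le_of_opNorm_le (hS₁ s hs) _
    _ = ‖S (t - s) x - x‖ := one_mul _

theorem continuous_extendSemigroup_apply (hS : IsC0Semigroup S) (hS₁ : ∀ t, 0 ≤ t → ‖S t‖ ≤ 1)
    (x : E) : Continuous fun t => extendSemigroup S t x := by
  have hzero : Tendsto (fun h => ‖S h x - x‖) (𝓝[≥] 0) (𝓝 0) := by
    refine tendsto_iff_norm_sub_tendsto_zero.1 ?_
    have h := hS.tendsto_zero x
    have hS0 : S 0 x = x := by rw [hS.map_zero, ContinuousLinearMap.id_apply]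
    nth_rewrite 2 [← hS0] at h ⊢
    exact continuousWithinAt_Ioi_iff_Ici.1 h
  refine continuous_iff_continuousAt.2 fun t => tendsto_iff_norm_sub_tendsto_zero.2 ?_
  refine squeeze_zero (fun _ => norm_nonneg _) (fun s => hS.norm_apply_sub_apply_le hS₁
    (le_max_right t 0) (le_max_right s 0) x) (hzero.comp (tendsto_nhdsWithin_iff.2 ⟨?_, ?_⟩))
  · have hc : Continuous fun s : ℝ => |max s 0 - max t 0| := by fun_prop
    simpa using hc.tendsto t
  · exact Eventually.of_forall fun s => mem_Ici.2 (abs_nonneg _)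

end IsC0Semigroup

/-- A `C₀` semigroup with `‖S(t)‖ ≤ e^{-ωt}` for some rate `ω > 0`. -/
structure IsExpStableSemigroup (S : ℝ → E →L[ℝ] E) (ω : ℝ) : Prop extends IsC0Semigroup S where
  rate_pos : 0 < ω
  norm_le : ∀ t : ℝ, 0 ≤ t → ‖S t‖ ≤ Real.exp (-ω * t)

namespace IsExpStableSemigroup

theorem norm_le_one (hS : IsExpStableSemigroup S ω) (t : ℝ) (ht : 0 ≤ t) : ‖S t‖ ≤ 1 :=
  (hS.norm_le t ht).trans (Real.exp_le_one_iff.2 (by nlinarith [mul_nonneg hS.rate_pos.le ht]))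

theorem norm_extendSemigroup_apply_le (hS : IsExpStableSemigroup S ω) (t : ℝ) (x : E) :
    ‖extendSemigroup S t x‖ ≤ ‖x‖ := by
  simpa only [one_mul] using
    (extendSemigroup S t).le_of_opNorm_le (hS.norm_le_one _ (le_max_right t 0)) x

theorem lipschitzWith_extendSemigroup (hS : IsExpStableSemigroup S ω) (t : ℝ) :
    LipschitzWith 1 (extendSemigroup S t) :=
  ContinuousLinearMap.lipschitzWith_of_opNorm_le (hS.norm_le_one _ (le_max_right t 0))

theorem continuous_extendSemigroup_apply (hS : IsExpStableSemigroup S ω) (x : E) :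
    Continuous fun t => extendSemigroup S t x :=
  hS.toIsC0Semigroup.continuous_extendSemigroup_apply hS.norm_le_one x

theorem continuous_extendSemigroup (hS : IsExpStableSemigroup S ω) :
    Continuous fun p : ℝ × E => extendSemigroup S p.1 p.2 :=
  continuous_prod_of_continuous_lipschitzWith' _ 1 hS.lipschitzWith_extendSemigroup
    hS.continuous_extendSemigroup_apply

theorem norm_apply_le (hS : IsExpStableSemigroup S ω) (u : E) {t : ℝ} (ht : t ∈ Ioi 0) :
    ‖S t u‖ ≤ Real.exp (-ω * t) * ‖u‖ :=
  (S t).le_of_opNorm_le (hS.norm_le t (mem_Ioi.1 ht).le) u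

theorem integrableOn_Ioi (hS : IsExpStableSemigroup S ω) (u : E) :
    IntegrableOn (fun t => S t u) (Ioi 0) := by
  refine Integrable.mono' ((exp_neg_integrableOn_Ioi 0 hS.rate_pos).mul_const ‖u‖) ?_ ?_
  · refine ContinuousOn.aestronglyMeasurable ?_ measurableSet_Ioi
    refine (hS.continuous_extendSemigroup_apply u).continuousOn.congr fun t ht => ?_
    simp only [extendSemigroup_of_nonneg (mem_Ioi.1 ht).le]
  · filter_upwards [ae_restrict_mem measurableSet_Ioi] with t ht using hS.norm_apply_le u ht

theorem norm_integral_Ioi_le (hS : IsExpStableSemigroup S ω) (u : E) :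
    ‖∫ t in Ioi (0 : ℝ), S t u‖ ≤ ω⁻¹ * ‖u‖ := by
  calc ‖∫ t in Ioi (0 : ℝ), S t u‖ ≤ ∫ t in Ioi (0 : ℝ), Real.exp (-ω * t) * ‖u‖ := by
        refine norm_integral_le_of_norm_le
          ((exp_neg_integrableOn_Ioi 0 hS.rate_pos).mul_const _) ?_
        filter_upwards [ae_restrict_mem measurableSet_Ioi] with t ht using hS.norm_apply_le u ht
    _ = ω⁻¹ * ‖u‖ := by
        rw [integral_mul_const, integral_exp_mul_Ioi (neg_neg_iff_pos.2 hS.rate_pos)]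
        simp [neg_div_neg_eq]

/-- The operator `∫₀^∞ S(t) dt`, which is the resolvent at `0` of the generator of `S`. -/
def resolventZero (hS : IsExpStableSemigroup S ω) : E →L[ℝ] E :=
  LinearMap.mkContinuous
    { toFun := fun u => ∫ t in Ioi (0 : ℝ), S t u
      map_add' := fun u v => by
        simp only [map_add]
        exact integral_add (hS.integrableOn_Ioi u) (hS.integrableOn_Ioi v)
      map_smul' := fun a u => by
        simp only [map_smul, RingHom.id_apply]
        exact integral_smul a _ }
    ω⁻¹ hS.norm_integral_Ioi_le

theorem resolventZero_apply (hS : IsExpStableSemigroup S ω) (u : E) :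
    hS.resolventZero u = ∫ t in Ioi (0 : ℝ), S t u := rfl

theorem lipschitzWith_resolventZero (hS : IsExpStableSemigroup S ω) :
    LipschitzWith ω⁻¹.toNNReal hS.resolventZero :=
  ContinuousLinearMap.lipschitzWith_of_opNorm_le (LinearMap.mkContinuous_norm_le' _ _)

section Complete

variable [CompleteSpace E] {S' : ℝ → E →L[ℝ] E}

theorem apply_resolventZero (hS : IsExpStableSemigroup S ω) {h : ℝ} (hh : 0 ≤ h) (u : E) :
    S h (hS.resolventZero u) = hS.resolventZero u - ∫ r in (0 : ℝ)..h, extendSemigroup S r u := by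
  have hi := hS.integrableOn_Ioi u
  have hshift : S h (hS.resolventZero u) = ∫ t in Ioi h, S t u := by
    have hpre := (measurePreserving_add_left (volume : Measure ℝ) h).setIntegral_preimage_emb
      (measurableEmbedding_addLeft h) (fun t => S t u) (Ioi h)
    rw [resolventZero_apply, ← (S h).integral_comp_comm hi, ← hpre]
    simp only [preimage_const_add_Ioi, sub_self]
    exact setIntegral_congr_fun measurableSet_Ioi fun t ht =>
      hS.apply_apply hh (mem_Ioi.1 ht).le u
  have hext : ∫ r in (0 : ℝ)..h, extendSemigroup S r u = ∫ r in (0 : ℝ)..h, S r u := by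
    refine intervalIntegral.integral_congr fun r hr => ?_
    rw [uIcc_of_le hh] at hr
    simp only [extendSemigroup_of_nonneg hr.1]
  rw [hshift, hext, ← intervalIntegral.integral_Ioi_sub_Ioi hi hh, resolventZero_apply,
    sub_sub_cancel]

theorem apply_resolventZero_comm (hS : IsExpStableSemigroup S ω) {h : ℝ} (hh : 0 ≤ h) (u : E) :
    S h (hS.resolventZero u) = hS.resolventZero (S h u) := by
  rw [resolventZero_apply, resolventZero_apply, ← (S h).integral_comp_comm (hS.integrableOn_Ioi u)]
  refine setIntegral_congr_fun measurableSet_Ioi fun t ht => ?_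
  simp only [hS.apply_apply hh (mem_Ioi.1 ht).le, hS.apply_apply (mem_Ioi.1 ht).le hh, add_comm]

theorem hasDerivAt_integral (hS : IsExpStableSemigroup S ω) (u : E) (t : ℝ) :
    HasDerivAt (fun s => ∫ r in (0 : ℝ)..s, extendSemigroup S r u) (extendSemigroup S t u) t :=
  ((hS.continuous_extendSemigroup_apply u).integral_hasStrictDerivAt 0 t).hasDerivAt

theorem hasDerivAt_extendSemigroup_resolventZero (hS : IsExpStableSemigroup S ω) (u : E) {t : ℝ}
    (ht : 0 < t) :
    HasDerivAt (fun s => extendSemigroup S s (hS.resolventZero u)) (-extendSemigroup S t u) t := by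
  refine ((hS.hasDerivAt_integral u t).const_sub (hS.resolventZero u)).congr_of_eventuallyEq ?_
  filter_upwards [lt_mem_nhds ht] with s hs
  rw [extendSemigroup_of_nonneg hs.le, hS.apply_resolventZero hs.le]

theorem tendsto_differenceQuotient_resolventZero (hS : IsExpStableSemigroup S ω) (u : E) :
    Tendsto (fun h : ℝ => h⁻¹ • (S h (hS.resolventZero u) - hS.resolventZero u)) (𝓝[>] 0)
      (𝓝 (-u)) := by
  have hslope := hasDerivAt_iff_tendsto_slope.1 (hS.hasDerivAt_integral u 0)
  rw [hS.extendSemigroup_zero] at hslope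
  have hright := hslope.mono_left (nhdsWithin_mono _ fun x (hx : 0 < x) => hx.ne')
  refine hright.neg.congr' ?_
  filter_upwards [self_mem_nhdsWithin] with h hh
  rw [hS.apply_resolventZero (mem_Ioi.1 hh).le]
  simp [slope]

theorem denseRange_resolventZero (hS : IsExpStableSemigroup S ω) :
    DenseRange hS.resolventZero := fun x => by
  refine mem_closure_of_tendsto
    (by simpa using (hS.tendsto_differenceQuotient_resolventZero x).neg) ?_
  filter_upwards [self_mem_nhdsWithin] with h hh
  refine ⟨-(h⁻¹ • (S h x - x)), ?_⟩
  rw [map_neg, map_smul, map_sub, hS.apply_resolventZero_comm (mem_Ioi.1 hh).le]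

theorem resolventZero_eq_neg_of_tendsto (hS : IsExpStableSemigroup S ω) {x y : E}
    (hxy : Tendsto (fun h : ℝ => h⁻¹ • (S h x - x)) (𝓝[>] 0) (𝓝 y)) :
    hS.resolventZero y = -x := by
  refine tendsto_nhds_unique ((hS.resolventZero.continuous.tendsto y).comp hxy)
    ((hS.tendsto_differenceQuotient_resolventZero x).congr' ?_)
  filter_upwards [self_mem_nhdsWithin] with h hh
  rw [Function.comp_apply, map_smul, map_sub, hS.apply_resolventZero_comm (mem_Ioi.1 hh).le]

theorem resolventOp_zero (hS : IsExpStableSemigroup S ω) {G : E →ₗ.[ℝ] E}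
    (hG : IsInfinitesimalGenerator G S) (u : E) : resolventOp G 0 u = hS.resolventZero u := by
  obtain ⟨x, hx, hGx⟩ := LinearPMap.mem_graph_iff _ |>.1
    ((hG _ _).2 (hS.tendsto_differenceQuotient_resolventZero u))
  simp only at hx hGx
  have eq_of_solves : ∀ y : G.domain, (0 : ℝ) • (y : E) - G y = u → (y : E) = x := by
    intro y hy
    rw [zero_smul, zero_sub, neg_eq_iff_eq_neg] at hy
    have h := hS.resolventZero_eq_neg_of_tendsto ((hG _ _).1 (G.mem_graph y))
    rw [hy, map_neg, neg_inj] at h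
    rw [hx, h]
  have hex : ∃! y : G.domain, (0 : ℝ) • (y : E) - G y = u :=
    ⟨x, by simp [hGx], fun y hy => Subtype.ext (eq_of_solves y hy)⟩
  rw [resolventOp, dif_pos hex, eq_of_solves _ hex.choose_spec.1, hx]

theorem norm_extendSemigroup_resolventZero_sub_le (hS : IsExpStableSemigroup S ω) (u : E)
    (s t : ℝ) :
    ‖extendSemigroup S s (hS.resolventZero u) - extendSemigroup S t (hS.resolventZero u)‖ ≤
      ‖u‖ * |s - t| := by
  have hi := fun a b => (hS.continuous_extendSemigroup_apply u).intervalIntegrable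
    (μ := volume) a b
  have hint : extendSemigroup S s (hS.resolventZero u) - extendSemigroup S t (hS.resolventZero u) =
      ∫ r in (max s 0)..(max t 0), extendSemigroup S r u := by
    rw [← intervalIntegral.integral_interval_sub_left (hi 0 (max t 0)) (hi 0 (max s 0)),
      extendSemigroup.eq_1 S s, extendSemigroup.eq_1 S t,
      hS.apply_resolventZero (le_max_right s 0), hS.apply_resolventZero (le_max_right t 0),
      sub_sub_sub_cancel_left]
  calc _ = ‖∫ r in (max s 0)..(max t 0), extendSemigroup S r u‖ := by rw [hint]
    _ ≤ ‖u‖ * |max t 0 - max s 0| := intervalIntegral.norm_integral_le_of_norm_le_const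
        fun r _ => hS.norm_extendSemigroup_apply_le r u
    _ ≤ ‖u‖ * |s - t| := by
        rw [abs_sub_comm s t]
        exact mul_le_mul_of_nonneg_left (abs_max_sub_max_le_abs _ _ _) (norm_nonneg u)

theorem hasDerivAt_semigroup_resolventZero_semigroup (hS : IsExpStableSemigroup S ω)
    (hS' : IsExpStableSemigroup S' ω) (u : E) {s t : ℝ} (hs : s ∈ Ioo 0 t) :
    HasDerivAt (fun s => extendSemigroup S' (t - s)
        (hS'.resolventZero (extendSemigroup S s (hS.resolventZero u))))
      (extendSemigroup S' (t - s) (hS.resolventZero (extendSemigroup S s u) -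
        hS'.resolventZero (extendSemigroup S s u))) s := by
  set v := extendSemigroup S s (hS.resolventZero u) with hv
  have inner := hS.hasDerivAt_extendSemigroup_resolventZero u hs.1
  have outer : HasDerivAt (fun r => extendSemigroup S' (t - r) (hS'.resolventZero v))
      (extendSemigroup S' (t - s) v) s := by
    simpa [Function.comp_def] using (hS'.hasDerivAt_extendSemigroup_resolventZero v
      (sub_pos.2 hs.2)).scomp s ((hasDerivAt_id s).const_sub t)
  have hcomm : v = hS.resolventZero (extendSemigroup S s u) := by
    rw [hv, extendSemigroup_of_nonneg hs.1.le, hS.apply_resolventZero_comm hs.1.le]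
  rw [hasDerivAt_iff_tendsto_slope] at inner outer ⊢
  have inner' : Tendsto (fun r => extendSemigroup S' (t - r) (hS'.resolventZero
      (slope (fun s => extendSemigroup S s (hS.resolventZero u)) s r))) (𝓝[≠] s)
      (𝓝 (extendSemigroup S' (t - s) (hS'.resolventZero (-extendSemigroup S s u)))) := by
    have hsub : Tendsto (fun r => t - r) (𝓝[≠] s) (𝓝 (t - s)) :=
      ((continuous_const.sub continuous_id).tendsto s).mono_left nhdsWithin_le_nhds
    exact (hS'.continuous_extendSemigroup.tendsto _).comp
      (hsub.prodMk_nhds ((hS'.resolventZero.continuous.tendsto _).comp inner))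
  -- `S'` is only strongly continuous, so the product rule is derived from the slopes.
  have hsum := inner'.add outer
  rw [← map_add, map_neg, neg_add_eq_sub, hcomm] at hsum
  refine hsum.congr fun r => ?_
  simp only [slope, vsub_eq_sub, map_smul, map_sub, ← hcomm, ← hv, ← smul_add]
  congr 1
  abel

theorem norm_resolventZero_comm_sub_le (hS : IsExpStableSemigroup S ω)
    (hS' : IsExpStableSemigroup S' ω) {t : ℝ} (ht : 0 ≤ t) (u : E) :
    ‖hS'.resolventZero (S t (hS.resolventZero u)) -
        S' t (hS'.resolventZero (hS.resolventZero u))‖ ≤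
      ∫ s in (0 : ℝ)..t, ‖hS.resolventZero (extendSemigroup S s u) -
        hS'.resolventZero (extendSemigroup S s u)‖ := by
  have hV : ∀ v, Continuous fun s => extendSemigroup S s v := hS.continuous_extendSemigroup_apply
  have hV' : ∀ {g : ℝ → E}, Continuous g → Continuous fun s => extendSemigroup S' (t - s) (g s) :=
    fun hg => hS'.continuous_extendSemigroup.comp ((continuous_const.sub continuous_id).prodMk hg)
  have hdiff : Continuous fun s => hS.resolventZero (extendSemigroup S s u) -
      hS'.resolventZero (extendSemigroup S s u) :=
    (hS.resolventZero.continuous.comp (hV u)).sub (hS'.resolventZero.continuous.comp (hV u))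
  have hftc := intervalIntegral.integral_eq_sub_of_hasDerivAt_of_le ht
    (hV' (hS'.resolventZero.continuous.comp (hV _))).continuousOn
    (fun s hs => hS.hasDerivAt_semigroup_resolventZero_semigroup hS' u hs)
    ((hV' hdiff).intervalIntegrable 0 t)
  simp only [Function.comp_apply] at hftc
  rw [sub_self, sub_zero, hS.extendSemigroup_zero, hS'.extendSemigroup_zero,
    extendSemigroup_of_nonneg ht, extendSemigroup_of_nonneg ht] at hftc
  rw [← hftc]
  refine (intervalIntegral.norm_integral_le_integral_norm ht).trans ?_
  exact intervalIntegral.integral_mono_on ht ((hV' hdiff).norm.intervalIntegrable _ _)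
    (hdiff.norm.intervalIntegrable _ _) fun s _ => hS'.norm_extendSemigroup_apply_le _ _

end Complete

end IsExpStableSemigroup

end Semigroup

section TrotterKato

variable {E : Type*} [NormedAddCommGroup E] [NormedSpace ℝ E] [CompleteSpace E] {ω : ℝ}

theorem tendsto_of_lipschitzWith_of_dense {ι α β : Type*} [PseudoMetricSpace α]
    [PseudoMetricSpace β] {l : Filter ι} {F : ι → α → β} {g : α → β} {K : ℝ≥0}
    (hF : ∀ i, LipschitzWith K (F i)) (hg : Continuous g) {s : Set α} (hs : Dense s)
    (h : ∀ w ∈ s, ∃ y : ι → α, Tendsto y l (𝓝 w) ∧ Tendsto (fun i => F i (y i)) l (𝓝 (g w)))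
    (x : α) : Tendsto (fun i => F i x) l (𝓝 (g x)) := by
  have hF' : EquicontinuousAt F x := (LipschitzWith.uniformEquicontinuous F K hF).equicontinuous x
  refine hF'.tendsto_of_mem_closure hg.continuousWithinAt.tendsto (fun w hw => ?_) (hs x)
  obtain ⟨y, hy, hFy⟩ := h w hw
  refine hFy.congr_dist (squeeze_zero (fun _ => dist_nonneg) (fun i => (hF i).dist_le_mul _ _) ?_)
  simpa using (tendsto_iff_dist_tendsto_zero.1 hy).const_mul (K : ℝ)

namespace IsExpStableSemigroup

theorem continuous_resolventZero_of_resolventContinuous {A : I → E →ₗ.[ℝ] E}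
    {S : I → ℝ → E →L[ℝ] E} (hS : ∀ lam, IsExpStableSemigroup (S lam) ω)
    (hgen : ∀ lam, IsInfinitesimalGenerator (-(A lam)) (S lam)) (hres : ResolventContinuous A ω)
    (u : E) : Continuous fun lam => (hS lam).resolventZero u := by
  refine continuous_iff_seqContinuous.2 fun l l₀ hl => ?_
  simpa only [Function.comp_def, (hS _).resolventOp_zero (hgen _)] using
    hres l l₀ hl 0 (neg_lt_zero.2 (hS l₀).rate_pos) u

variable {X : Type*} [TopologicalSpace X] {S : X → ℝ → E →L[ℝ] E}
  (hS : ∀ m, IsExpStableSemigroup (S m) ω) (hR : ∀ u, Continuous fun m => (hS m).resolventZero u)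

include hR

theorem tendsto_extendSemigroup_resolventZero_resolventZero (l : X)
    (t : ℝ) (u : E) :
    Tendsto (fun m => extendSemigroup (S m) t ((hS m).resolventZero ((hS l).resolventZero u)))
      (𝓝 l) (𝓝 (extendSemigroup (S l) t ((hS l).resolventZero ((hS l).resolventZero u)))) := by
  set w := (hS l).resolventZero u
  have hR' : Continuous fun p : X × E => (hS p.1).resolventZero p.2 :=
    continuous_prod_of_continuous_lipschitzWith' _ _ (fun m => (hS m).lipschitzWith_resolventZero)
      hR
  have hV : Continuous fun s => extendSemigroup (S l) s u :=
    (hS l).continuous_extendSemigroup_apply u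
  have hint : Continuous fun m => ∫ s in (0 : ℝ)..max t 0,
      ‖(hS l).resolventZero (extendSemigroup (S l) s u) -
        (hS m).resolventZero (extendSemigroup (S l) s u)‖ := by
    refine intervalIntegral.continuous_parametric_intervalIntegral_of_continuous' ?_ _ _
    exact (((hS l).resolventZero.continuous.comp (hV.comp continuous_snd)).sub
      (hR'.comp (continuous_fst.prodMk (hV.comp continuous_snd)))).norm
  have hint0 := hint.tendsto l
  simp only [sub_self, norm_zero, intervalIntegral.integral_zero] at hint0
  have hlim := (hR (extendSemigroup (S l) t w)).tendsto l
  rw [extendSemigroup, ← (hS l).apply_resolventZero_comm (le_max_right t 0)] at hlim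
  refine hlim.congr_dist (squeeze_zero (fun _ => dist_nonneg) (fun m => ?_) hint0)
  rw [dist_eq_norm]
  exact (hS l).norm_resolventZero_comm_sub_le (hS m) (le_max_right t 0) u

theorem continuous_extendSemigroup_param (t : ℝ) (x : E) :
    Continuous fun m => extendSemigroup (S m) t x := by
  refine continuous_iff_continuousAt.2 fun l => ?_
  have hdense := (hS l).denseRange_resolventZero
  refine tendsto_of_lipschitzWith_of_dense (fun m => (hS m).lipschitzWith_extendSemigroup t)
    (extendSemigroup (S l) t).continuous (hdense.comp hdense (hS l).resolventZero.continuous) ?_ x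
  rintro _ ⟨u, rfl⟩
  exact ⟨fun m => (hS m).resolventZero ((hS l).resolventZero u), (hR _).tendsto l,
    tendsto_extendSemigroup_resolventZero_resolventZero hS hR l t u⟩

theorem continuous_extendSemigroup_resolventZero (w : E) :
    Continuous fun p : X × ℝ => extendSemigroup (S p.1) p.2 ((hS p.1).resolventZero w) := by
  refine continuous_prod_of_continuous_lipschitzWith' _ ‖w‖₊ (fun m => ?_) fun t => ?_
  · exact LipschitzWith.of_dist_le_mul fun s t => by
      simpa only [dist_eq_norm, Real.norm_eq_abs, coe_nnnorm] using
        (hS m).norm_extendSemigroup_resolventZero_sub_le w s t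
  · have hV : Continuous fun p : X × E => extendSemigroup (S p.1) t p.2 :=
      continuous_prod_of_continuous_lipschitzWith' _ 1
        (fun m => (hS m).lipschitzWith_extendSemigroup t)
        (continuous_extendSemigroup_param hS hR t)
    exact hV.comp (continuous_id.prodMk (hR w))

theorem continuous_extendSemigroup_family :
    Continuous fun p : X × ℝ × E => extendSemigroup (S p.1) p.2.1 p.2.2 := by
  have hV : ∀ x, Continuous fun q : X × ℝ => extendSemigroup (S q.1) q.2 x := fun x => by
    refine continuous_iff_continuousAt.2 fun q => ?_
    refine tendsto_of_lipschitzWith_of_dense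
      (fun q : X × ℝ => (hS q.1).lipschitzWith_extendSemigroup q.2)
      (extendSemigroup (S q.1) q.2).continuous (hS q.1).denseRange_resolventZero ?_ x
    rintro _ ⟨w, rfl⟩
    exact ⟨fun p => (hS p.1).resolventZero w, ((hR w).comp continuous_fst).tendsto q,
      (continuous_extendSemigroup_resolventZero hS hR w).tendsto q⟩
  exact (continuous_prod_of_continuous_lipschitzWith'
    (fun p : (X × ℝ) × E => extendSemigroup (S p.1.1) p.1.2 p.2) 1
    (fun q : X × ℝ => (hS q.1).lipschitzWith_extendSemigroup q.2) hV).comp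
    ((continuous_fst.prodMk continuous_snd.fst).prodMk continuous_snd.snd)

end IsExpStableSemigroup

end TrotterKato

section MildSolution

variable {E : Type*} [NormedAddCommGroup E] {F F' : ℝ × E × I → E} {J : Set ℝ} {k : ℝ}

theorem IsPerturbation.continuous (hF : IsPerturbation F univ k) : Continuous F :=
  continuousOn_univ.1 (univ_prod_univ ▸ hF.continuousOn)

theorem IsPerturbation.exists_extension (hF : IsPerturbation F J k) {r : ℝ → ℝ}
    (hr : Continuous r) (hrJ : ∀ t, r t ∈ J) (hrid : ∀ t ∈ J, r t = t) :
    ∃ F', IsPerturbation F' univ k ∧ EqOn F' F (J ×ˢ univ) := by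
  refine ⟨fun p => F (r p.1, p.2), ⟨?_, fun x => ?_, ?_, hF.k_nonneg, fun Ω hΩ => ?_⟩,
    fun p hp => by simp only [hrid p.1 hp.1]⟩
  · exact (hF.continuousOn.comp_continuous
      (by fun_prop : Continuous fun p : ℝ × E × I => (r p.1, p.2))
      fun p => mk_mem_prod (hrJ p.1) (mem_univ _)).continuousOn
  · obtain ⟨δ, hδ, L, hL, h⟩ := hF.locallyLipschitz x
    exact ⟨δ, hδ, L, hL, fun x₁ h₁ x₂ h₂ t _ => h x₁ h₁ x₂ h₂ _ (hrJ t)⟩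
  · obtain ⟨c, hc, h⟩ := hF.linearGrowth
    exact ⟨c, hc, fun x t _ => h x _ (hrJ t)⟩
  · refine (hausdorffMNC_mono ?_).trans (hF.setContraction Ω hΩ)
    rintro _ ⟨p, hp, rfl⟩
    exact ⟨(r p.1, p.2), ⟨hrJ p.1, hp.2⟩, rfl⟩

variable [NormedSpace ℝ E] {S : I → ℝ → E →L[ℝ] E} {ω : ℝ}

theorem isMildSolution_congr {S : ℝ → E →L[ℝ] E} {lam : I} {x : E} {u : ℝ → E}
    (hJ : ∀ t ∈ J, 0 ≤ t ∧ Icc 0 t ⊆ J) (hF : EqOn F F' (J ×ˢ univ)) :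
    IsMildSolution S F lam J x u ↔ IsMildSolution S F' lam J x u := by
  refine and_congr_right fun _ => forall₂_congr fun t ht => ?_
  rw [intervalIntegral.integral_congr fun τ hτ => ?_]
  rw [uIcc_of_le (hJ t ht).1] at hτ
  simp only [hF (mk_mem_prod ((hJ t ht).2 hτ) (mem_univ (u τ, lam)))]

/-- The kernel `S(t - τ) F(τ, y, lam)` of the Volterra equation solved by mild solutions. -/
def mildKernel (S : I → ℝ → E →L[ℝ] E) (F : ℝ × E × I → E) (lam : I) (t τ : ℝ) (y : E) : E :=
  extendSemigroup (S lam) (t - τ) (F (τ, y, lam))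

theorem isMildSolution_iff_isVolterraSolution {lam : I} {x : E} {u : ℝ → E}
    (hJ : ∀ t ∈ J, 0 ≤ t) :
    IsMildSolution (S lam) F lam J x u ↔
      IsVolterraSolution (mildKernel S F lam) (fun t => extendSemigroup (S lam) t x) 0 J u := by
  refine and_congr_right fun _ => forall₂_congr fun t ht => ?_
  have hint : ∫ τ in (0 : ℝ)..t, mildKernel S F lam t τ (u τ) =
      ∫ τ in (0 : ℝ)..t, S lam (t - τ) (F (τ, u τ, lam)) :=
    intervalIntegral.integral_congr fun τ hτ => by
      rw [uIcc_of_le (hJ t ht)] at hτ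
      simp only [mildKernel, extendSemigroup_of_nonneg (sub_nonneg.2 hτ.2)]
  rw [volterraMap, hint, extendSemigroup_of_nonneg (hJ t ht)]

theorem exists_norm_mildKernel_le (hS : ∀ lam, IsExpStableSemigroup (S lam) ω)
    (hF : IsPerturbation F univ k) :
    ∃ c : ℝ≥0, ∀ lam t τ y, ‖mildKernel S F lam t τ y‖ ≤ c * (1 + ‖y‖) := by
  obtain ⟨c, hc, h⟩ := hF.linearGrowth
  exact ⟨⟨c, hc.le⟩, fun lam t τ y =>
    ((hS lam).norm_extendSemigroup_apply_le _ _).trans (h y τ (mem_univ τ) lam)⟩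

theorem uniformlyLocallyLipschitz_mildKernel (hS : ∀ lam, IsExpStableSemigroup (S lam) ω)
    (hF : IsPerturbation F univ k) :
    UniformlyLocallyLipschitz fun i : I × ℝ × ℝ => mildKernel S F i.1 i.2.1 i.2.2 := fun x => by
  obtain ⟨δ, hδ, L, hL, h⟩ := hF.locallyLipschitz x
  refine ⟨⟨L, hL.le⟩, Metric.ball x δ, Metric.ball_mem_nhds x hδ, fun i =>
    LipschitzOnWith.of_dist_le_mul fun x₁ h₁ x₂ h₂ => ?_⟩
  simp only [mildKernel, dist_eq_norm, ← map_sub]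
  exact ((hS i.1).norm_extendSemigroup_apply_le _ _).trans
    (h x₁ h₁ x₂ h₂ i.2.2 (mem_univ _) i.1)

theorem continuous_mildKernel
    (hScont : Continuous fun p : I × ℝ × E => extendSemigroup (S p.1) p.2.1 p.2.2)
    (hF : Continuous F) :
    Continuous fun p : I × ℝ × ℝ × E => mildKernel S F p.1 p.2.1 p.2.2.1 p.2.2.2 :=
  hScont.comp (continuous_fst.prodMk ((by fun_prop : Continuous fun p : I × ℝ × ℝ × E =>
    p.2.1 - p.2.2.1).prodMk (hF.comp (by fun_prop : Continuous fun p : I × ℝ × ℝ × E =>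
      (p.2.2.1, p.2.2.2, p.1)))))

theorem continuous_mildKernel_apply
    (hScont : Continuous fun p : I × ℝ × E => extendSemigroup (S p.1) p.2.1 p.2.2)
    (hF : Continuous F) (lam : I) :
    Continuous fun p : ℝ × ℝ × E => mildKernel S F lam p.1 p.2.1 p.2.2 :=
  (continuous_mildKernel hScont hF).comp (continuous_const.prodMk continuous_id)

theorem hausdorffMNC_image2_extendSemigroup_le (hS : ∀ lam, IsExpStableSemigroup (S lam) ω)
    (hScont : Continuous fun p : I × ℝ × E => extendSemigroup (S p.1) p.2.1 p.2.2) {t : ℝ}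
    (ht : 0 ≤ t) (Ω : Set E) :
    hausdorffMNC (image2 (fun lam => extendSemigroup (S lam) t) univ Ω) ≤
      ENNReal.ofReal (Real.exp (-ω * t)) * hausdorffMNC Ω := by
  refine hausdorffMNC_image2_univ_le_mul (Real.toNNReal_pos.2 (Real.exp_pos _)).ne' (fun lam => ?_)
    (fun y => hScont.comp (by fun_prop : Continuous fun lam : I => (lam, t, y))) Ω
  refine ContinuousLinearMap.lipschitzWith_of_opNorm_le (f := extendSemigroup (S lam) t) ?_
  rw [extendSemigroup_of_nonneg ht, Real.coe_toNNReal _ (Real.exp_pos _).le]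
  exact (hS lam).norm_le t ht

theorem hausdorffMNC_range_mildKernel_le (hS : ∀ lam, IsExpStableSemigroup (S lam) ω)
    (hScont : Continuous fun p : I × ℝ × E => extendSemigroup (S p.1) p.2.1 p.2.2)
    (hF : IsPerturbation F univ k) {ι : Type*} (lam : ι → I) {y : ι → E}
    (hy : Bornology.IsBounded (range y)) {t τ : ℝ} (hτ : τ ≤ t) :
    hausdorffMNC (range fun i => mildKernel S F (lam i) t τ (y i)) ≤
      ENNReal.ofReal (Real.exp (-ω * (t - τ))) *
        (ENNReal.ofReal k * hausdorffMNC (range y)) := by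
  have hsub : (range fun i => mildKernel S F (lam i) t τ (y i)) ⊆
      image2 (fun lam => extendSemigroup (S lam) (t - τ)) univ
        (F '' (univ ×ˢ range y ×ˢ univ)) := by
    rintro _ ⟨i, rfl⟩
    exact mem_image2_of_mem (mem_univ _) (mem_image_of_mem F
      (mk_mem_prod (mem_univ _) (mk_mem_prod (mem_range_self i) (mem_univ _))))
  refine (hausdorffMNC_mono hsub).trans ((hausdorffMNC_image2_extendSemigroup_le hS hScont
    (sub_nonneg.2 hτ) _).trans ?_)
  gcongr
  exact hF.setContraction _ hy

section Solutions

variable (hS : ∀ lam, IsExpStableSemigroup (S lam) ω)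
  (hScont : Continuous fun p : I × ℝ × E => extendSemigroup (S p.1) p.2.1 p.2.2)
  (hF : IsPerturbation F univ k)

include hS hScont hF

theorem existsUnique_isMildSolution_Icc [CompleteSpace E] {T : ℝ} (hT : 0 ≤ T) (x : E) (lam : I) :
    ∃! u : C(Icc (0 : ℝ) T, E), IsMildSolution (S lam) F lam (Icc 0 T) x (IccExtend hT u) := by
  simp only [isMildSolution_iff_isVolterraSolution fun t (ht : t ∈ Icc 0 T) => ht.1]
  have hK := continuous_mildKernel_apply hScont hF.continuous lam
  have hLip := (uniformlyLocallyLipschitz_mildKernel hS hF).comp_index fun i : ℝ × ℝ => (lam, i)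
  obtain ⟨c, hgrow⟩ := exists_norm_mildKernel_le hS hF
  obtain ⟨u, hu⟩ := exists_isVolterraSolution_Icc hK
    ((hS lam).continuous_extendSemigroup_apply x) hLip (hgrow lam) hT
  refine ⟨⟨(Icc 0 T).domRestrict u, hu.1.domRestrict⟩,
    hu.congr_eqOn (fun t ht => ⟨ht.1, Icc_subset_Icc_right ht.2⟩)
      fun t ht => IccExtend_of_mem hT _ ht, fun v hv => ?_⟩
  ext t
  rw [← IccExtend_val hT v t]
  exact hv.eqOn hK hLip hu t.2

theorem existsUnique_isMildSolution_Ici [CompleteSpace E] (x : E) (lam : I) :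
    ∃! u : C(Ici (0 : ℝ), E), IsMildSolution (S lam) F lam (Ici 0) x (IciExtend u) := by
  simp only [isMildSolution_iff_isVolterraSolution fun t (ht : t ∈ Ici 0) => ht]
  have hK := continuous_mildKernel_apply hScont hF.continuous lam
  have hLip := (uniformlyLocallyLipschitz_mildKernel hS hF).comp_index fun i : ℝ × ℝ => (lam, i)
  obtain ⟨c, hgrow⟩ := exists_norm_mildKernel_le hS hF
  obtain ⟨u, hu⟩ := exists_isVolterraSolution_Ici hK
    ((hS lam).continuous_extendSemigroup_apply x) hLip (hgrow lam) 0
  refine ⟨⟨(Ici 0).domRestrict u, hu.1.domRestrict⟩,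
    hu.congr_eqOn (fun t ht => ⟨ht, Icc_subset_Ici_self⟩)
      fun t ht => IciExtend_of_mem _ ht, fun v hv => ?_⟩
  ext t
  rw [← IciExtend_coe v t]
  exact (hv.mono Icc_subset_Ici_self).eqOn hK hLip (hu.mono Icc_subset_Ici_self)
    (right_mem_Icc.2 t.2)

theorem continuous_mildSolution {T : ℝ} (hT : 0 ≤ T) {u : E × I → C(Icc (0 : ℝ) T, E)}
    (hu : ∀ p, IsMildSolution (S p.2) F p.2 (Icc 0 T) p.1 (IccExtend hT (u p))) :
    Continuous u := by
  refine continuous_volterraSolution (K := fun p => mildKernel S F p.2)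
    (q := fun p t => extendSemigroup (S p.2) t p.1) ?_ ?_
    ((uniformlyLocallyLipschitz_mildKernel hS hF).comp_index
      fun i : (E × I) × ℝ × ℝ => (i.1.2, i.2)) hT
    fun p => (isMildSolution_iff_isVolterraSolution fun t ht => ht.1).1 (hu p)
  · exact (continuous_mildKernel hScont hF.continuous).comp
      (continuous_fst.snd.prodMk continuous_snd)
  · exact hScont.comp (by fun_prop : Continuous fun p : (E × I) × ℝ => (p.1.2, p.2, p.1.1))

theorem hausdorffMNC_range_mildSolution_le [CompleteSpace E]
    [TopologicalSpace.SeparableSpace E] {ι : Type*} {x : ι → E} {lam : ι → I} {T : ℝ}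
    (hT : 0 ≤ T) {u : ι → C(Icc (0 : ℝ) T, E)}
    (hu : ∀ i, IsMildSolution (S (lam i)) F (lam i) (Icc 0 T) (x i) (IccExtend hT (u i)))
    (hx : Bornology.IsBounded (range x)) (t : Icc (0 : ℝ) T) :
    hausdorffMNC (range fun i => u i t) ≤
      ENNReal.ofReal (Real.exp ((k - ω) * t)) * hausdorffMNC (range x) := by
  have hsol : ∀ i, IsVolterraSolution (mildKernel S F (lam i))
      (fun t => extendSemigroup (S (lam i)) t (x i)) 0 (Icc 0 T) (IccExtend hT (u i)) := fun i =>
    (isMildSolution_iff_isVolterraSolution fun t ht => ht.1).1 (hu i)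
  obtain ⟨Q, hQ⟩ := hx.exists_norm_le
  obtain ⟨c, hgrow⟩ := exists_norm_mildKernel_le hS hF
  have hbound : ∀ i τ, ‖IccExtend hT (u i) τ‖ ≤ (1 + Q) * Real.exp (c * (T - 0)) := fun i τ => by
    have h := (hsol i).norm_le (hgrow (lam i)) (fun s _ =>
      ((hS _).norm_extendSemigroup_apply_le s _).trans (hQ _ (mem_range_self i)))
      _ (projIcc 0 T hT τ).2
    rwa [IccExtend_val] at h
  have hinit : ∀ s ∈ Icc 0 T, hausdorffMNC (range fun i => extendSemigroup (S (lam i)) s (x i)) ≤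
      ENNReal.ofReal (Real.exp (-ω * (s - 0))) * hausdorffMNC (range x) := fun s hs => by
    rw [sub_zero]
    refine (hausdorffMNC_mono ?_).trans (hausdorffMNC_image2_extendSemigroup_le hS hScont hs.1 _)
    exact range_subset_iff.2 fun i => mem_image2_of_mem (mem_univ _) (mem_range_self i)
  have hle := hausdorffMNC_range_volterraSolution_le hF.k_nonneg
    (fun i => continuous_mildKernel_apply hScont hF.continuous (lam i)) hsol
    (fun i => (u i).continuous.Icc_extend') hbound
    (fun i s τ => (hgrow _ s τ _).trans
      (mul_le_mul_of_nonneg_left (add_le_add_right (hbound i τ) 1) c.2)) hinit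
    (fun s τ hτ => hausdorffMNC_range_mildKernel_le hS hScont hF lam
      (isBounded_iff_forall_norm_le.2 ⟨_, forall_mem_range.2 fun i => hbound i τ⟩) hτ) t t.2
  simpa only [IccExtend_val, sub_zero] using hle

theorem hausdorffMNC_image_mildSolution_le [CompleteSpace E]
    [TopologicalSpace.SeparableSpace E] {T : ℝ} (hT : 0 ≤ T) {u : E × I → C(Icc (0 : ℝ) T, E)}
    (hu : ∀ p, IsMildSolution (S p.2) F p.2 (Icc 0 T) p.1 (IccExtend hT (u p)))
    {Ω : Set E} (hΩ : Bornology.IsBounded Ω) (t : Icc (0 : ℝ) T) :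
    hausdorffMNC ((fun p => u p t) '' (Ω ×ˢ univ)) ≤
      ENNReal.ofReal (Real.exp ((k - ω) * t)) * hausdorffMNC Ω := by
  have hfst : range (fun p : ↥(Ω ×ˢ (univ : Set I)) => p.1.1) ⊆ Ω :=
    range_subset_iff.2 fun p => p.2.1
  rw [image_eq_range]
  refine (hausdorffMNC_range_mildSolution_le hS hScont hF hT
    (x := fun p : ↥(Ω ×ˢ (univ : Set I)) => p.1.1) (fun p => hu p) (hΩ.subset hfst) t).trans ?_
  gcongr
  exact hausdorffMNC_mono hfst

end Solutions

end MildSolution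

end EvolutionFamily

end

open EvolutionFamily

theorem mainTheorem9 {E : Type*} [NormedAddCommGroup E] [NormedSpace ℝ E] [CompleteSpace E]
    [TopologicalSpace.SeparableSpace E]
    (A : I → E →ₗ.[ℝ] E) (S : I → ℝ → E →L[ℝ] E) (ω : ℝ)
    (hdense : ∀ lam : I, Dense ((A lam).domain : Set E))
    (hS : ∀ lam : I, EvolutionFamily.IsC0Semigroup (S lam))
    (hgen : ∀ lam : I, EvolutionFamily.IsInfinitesimalGenerator (-(A lam)) (S lam))
    (hω : 0 < ω)
    (hcontr : ∀ lam : I, ∀ t : ℝ, 0 ≤ t → ‖S lam t‖ ≤ Real.exp (-ω * t))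
    (hres : EvolutionFamily.ResolventContinuous A ω) :
    (∀ (T : ℝ) (hT : 0 < T) (F : ℝ × E × I → E) (k : ℝ),
      EvolutionFamily.IsPerturbation F (Icc 0 T) k →
      ∃ u : E × I → C(Icc (0 : ℝ) T, E),
        -- existence and uniqueness
        (∀ (x : E) (lam : I) (v : C(Icc (0 : ℝ) T, E)),
          EvolutionFamily.IsMildSolution (S lam) F lam (Icc 0 T) x (IccExtend hT.le v) ↔
            v = u (x, lam)) ∧
        -- continuous dependence
        (∀ (x : ℕ → E) (l : ℕ → I) (x₀ : E) (l₀ : I),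
          Tendsto (fun n => (x n, l n)) atTop (𝓝 (x₀, l₀)) →
            Tendsto (fun n => u (x n, l n)) atTop (𝓝 (u (x₀, l₀)))) ∧
        -- compactness of the translation operator
        (∀ (t : Icc (0 : ℝ) T) (Ω : Set E), Bornology.IsBounded Ω →
          EvolutionFamily.hausdorffMNC ((fun p : E × I => u p t) '' (Ω ×ˢ univ)) ≤
            ENNReal.ofReal (Real.exp ((k - ω) * t)) * EvolutionFamily.hausdorffMNC Ω)) ∧
    -- existence and uniqueness on the half-line
    (∀ (F : ℝ × E × I → E) (k : ℝ), EvolutionFamily.IsPerturbation F (Ici 0) k →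
      ∀ (x : E) (lam : I), ∃! u : C(Ici (0 : ℝ), E),
        EvolutionFamily.IsMildSolution (S lam) F lam (Ici 0) x (IciExtend u)) := by
  have hstable : ∀ lam, IsExpStableSemigroup (S lam) ω := fun lam => ⟨hS lam, hω, hcontr lam⟩
  have hScont := IsExpStableSemigroup.continuous_extendSemigroup_family hstable
    (IsExpStableSemigroup.continuous_resolventZero_of_resolventContinuous hstable hgen hres)
  refine ⟨fun T hT F k hF => ?_, fun F k hF x lam => ?_⟩
  · obtain ⟨F', hF', hFF'⟩ := hF.exists_extension (continuous_subtype_val.comp continuous_projIcc)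
      (fun t => (projIcc 0 T hT.le t).2) fun t ht => congrArg Subtype.val (projIcc_of_mem hT.le ht)
    simp only [← isMildSolution_congr (fun _ ht => ⟨ht.1, Icc_subset_Icc_right ht.2⟩) hFF']
    choose u hu huniq using fun p : E × I =>
      existsUnique_isMildSolution_Icc hstable hScont hF' hT.le p.1 p.2
    refine ⟨u, fun x lam v => ⟨huniq (x, lam) v, fun hv => hv ▸ hu (x, lam)⟩, ?_, ?_⟩
    · exact fun x l x₀ l₀ h =>
        ((continuous_mildSolution hstable hScont hF' hT.le hu).tendsto (x₀, l₀)).comp h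
    · exact fun t Ω hΩ => hausdorffMNC_image_mildSolution_le hstable hScont hF' hT.le hu hΩ t
  · obtain ⟨F', hF', hFF'⟩ := hF.exists_extension (continuous_id.max continuous_const)
      (fun t => le_max_right t 0) fun t ht => max_eq_left ht
    simp only [← isMildSolution_congr (J := Ici 0) (fun _ ht => ⟨ht, Icc_subset_Ici_self⟩) hFF']
    exact existsUnique_isMildSolution_Ici hstable hScont hF' x lam
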